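/- Let $X$ be a complex Hilbert space, $Y$ a complex Banach space, and let $-A$ be the generator of a strongly continuous semigroup of contractions $(T(t))_{t\ge 0}$ on $X$. Let $D(A)$ and $R(A)$ denote the domain and the range of $A$, and let $C : D(A) \to Y$ be linear and bounded when $D(A)$ carries the graph norm $\|x\| + \|Ax\|$. Assume that $R(A)$ is dense in $X$ (then $A$ is injective, and for $x \in R(A)$ the fractional power $$A^{-1/2}x = \frac1\pi \int_0^\infty s^{-1/2}(s+A)^{-1}x\,ds$$ is well defined, with $A^{-1/2}x \in D(A)$ if $x \in D(A)\cap R(A)$), and that there is a constant $\delta > 0$ such that $$\|CA^{-1/2}x\|_Y \ge \delta \|x\| \qquad \text{for all } x \in D(A)\cap R(A).$$ Then there is a constant $m>0$ such that $$m^2\|x\|^2 \le \int_0^\infty \|CT(t)x\|_Y^2\,dt \qquad \text{for all } x \in D(A)\cap R(A).$$ If, in addition, either $A$ is boundedly invertible (that is, $0$ lies in the resolvent set of $A$) or $C$ is infinite-time admissible for $A$, that is, $$\sup_{x\in D(A),\ \|x\|=1} \int_0^\infty \|CT(t)x\|_Y^2\,dt < \infty,$$ then $C$ is exactly observable in infinite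 time for $A$, that is, $$\inf_{x\in D(A),\ \|x\|=1} \int_0^\infty \|CT(t)x\|_Y^2\,dt > 0.$$ (The integrals take values in $[0,\infty]$; the infimum may be $+\infty$.) -/

import Mathlib

open MeasureTheory Filter Topology
open scoped ENNReal

noncomputable section

namespace Observability

variable {X Y : Type*} [NormedAddCommGroup X] [InnerProductSpace ℂ X]
  [NormedAddCommGroup Y] [NormedSpace ℂ Y]

/-- A strongly continuous semigroup of contractions `(T t)_{t ≥ 0}` on `X`. Only the values at
`t ≥ 0` matter. -/
structure IsContractionSemigroup (T : ℝ → X →L[ℂ] X) : Prop where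
  map_zero : T 0 = ContinuousLinearMap.id ℂ X
  map_add : ∀ s t : ℝ, 0 ≤ s → 0 ≤ t → T (s + t) = (T s).comp (T t)
  continuousOn : ∀ x : X, ContinuousOn (fun t => T t x) (Set.Ici 0)
  norm_le_one : ∀ t : ℝ, 0 ≤ t → ‖T t‖ ≤ 1

/-- `G` is the generator of `T`: its domain consists of exactly those `x` for which
`lim_{t → 0+} (T t x - x) / t` exists, and `G x` is that limit. -/
def IsGenerator (T : ℝ → X →L[ℂ] X) (G : X →ₗ.[ℂ] X) : Prop :=
  ∀ x y : X, (x, y) ∈ G.graph ↔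
    Tendsto (fun t : ℝ => t⁻¹ • (T t x - x)) (𝓝[>] 0) (𝓝 y)

/-- The range `R(A)` of an unbounded operator. -/
def opRange (A : X →ₗ.[ℂ] X) : Submodule ℂ X := LinearMap.range A.toFun

/-- `A` is (boundedly) invertible, i.e. `0` belongs to the resolvent set of `A`. -/
def IsBoundedlyInvertible (A : X →ₗ.[ℂ] X) : Prop :=
  ∃ B : X →L[ℂ] X, (∀ x : A.domain, B (A x) = x) ∧
    ∀ y : X, ∃ h : B y ∈ A.domain, A ⟨B y, h⟩ = y

/-- `C : D(A) → Y` is bounded when `D(A)` carries the graph norm `‖x‖ + ‖A x‖`. -/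
def IsGraphBounded (A : X →ₗ.[ℂ] X) (C : A.domain →ₗ[ℂ] Y) : Prop :=
  ∃ K : ℝ, ∀ x : A.domain, ‖C x‖ ≤ K * (‖(x : X)‖ + ‖A x‖)

/-- `(s + A)⁻¹ x`, the inverse of the map `D(A) → X, y ↦ s y + A y`. If `-A` generates a
contraction semigroup, this map is a bijection for every `s > 0`. -/
def resolventAt (A : X →ₗ.[ℂ] X) (s : ℝ) : X → A.domain :=
  Function.invFun (fun y : A.domain => s • (y : X) + A y)

/-- `A^{-1/2} x` for `x ∈ R(A)`, by Balakrishnan's formula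
`A^{-1/2} x = π⁻¹ ∫_0^∞ s^{-1/2} (s + A)⁻¹ x ds`. If `-A` generates a contraction semigroup and
`A` is injective, the integral converges absolutely for every `x ∈ R(A) = D(A⁻¹)`, and it is the
usual Balakrishnan definition of the fractional power `(A⁻¹)^{1/2}` on `D(A⁻¹)`. -/
def negSqrt (A : X →ₗ.[ℂ] X) (x : X) : X :=
  (Real.pi)⁻¹ • ∫ s in Set.Ioi (0 : ℝ), (s ^ (-(1 / 2) : ℝ)) • (resolventAt A s x : X)

/-- The domain of the generator is invariant under the semigroup. -/
theorem IsGenerator.apply_mem_domain {T : ℝ → X →L[ℂ] X} (hT : IsContractionSemigroup T)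
    {A : X →ₗ.[ℂ] X} (hA : IsGenerator T (-A)) {x : X} (hx : x ∈ A.domain) {t : ℝ}
    (ht : 0 ≤ t) : T t x ∈ A.domain := by
  have h1 : (x, (-A) ⟨x, hx⟩) ∈ (-A).graph := (-A).mem_graph ⟨x, hx⟩
  have h2 := (hA _ _).1 h1
  have h3 : (T t x, T t ((-A) ⟨x, hx⟩)) ∈ (-A).graph := by
    rw [hA]
    refine (((T t).continuous.tendsto _).comp h2).congr' ?_
    filter_upwards [self_mem_nhdsWithin] with s hs
    have hs' : (0 : ℝ) ≤ s := le_of_lt hs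
    have e : T t (T s x) = T s (T t x) := by
      have e1 := hT.map_add t s ht hs'
      have e2 := hT.map_add s t hs' ht
      rw [add_comm, e2] at e1
      exact (congrArg (fun L : X →L[ℂ] X => L x) e1).symm
    simp [e]
  have h4 : T t x ∈ (-A).domain := LinearPMap.mem_domain_of_mem_graph h3
  exact h4

open Classical in
/-- The output `t ↦ C T(t) x`. For `x ∈ D(A)` and `t ≥ 0` one always has `T(t) x ∈ D(A)`
(see `IsGenerator.apply_mem_domain`), so the second branch plays no role. -/
def output (A : X →ₗ.[ℂ] X) (C : A.domain →ₗ[ℂ] Y) (T : ℝ → X →L[ℂ] X) (x : X) (t : ℝ) : Y :=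
  if h : T t x ∈ A.domain then C ⟨T t x, h⟩ else 0

/-- `∫_0^∞ ‖C T(t) x‖² dt`, as an element of `[0, ∞]`. -/
def outputEnergy (A : X →ₗ.[ℂ] X) (C : A.domain →ₗ[ℂ] Y) (T : ℝ → X →L[ℂ] X) (x : X) : ℝ≥0∞ :=
  ∫⁻ t in Set.Ioi (0 : ℝ), ‖output A C T x t‖ₑ ^ 2

/-- Infinite-time admissibility: `sup {∫_0^∞ ‖C T(t) x‖² dt : x ∈ D(A), ‖x‖ = 1} < ∞`. -/
def IsInfiniteTimeAdmissible (A : X →ₗ.[ℂ] X) (C : A.domain →ₗ[ℂ] Y)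
    (T : ℝ → X →L[ℂ] X) : Prop :=
  (⨆ (x : X) (_ : x ∈ A.domain) (_ : ‖x‖ = 1), outputEnergy A C T x) < ∞

/-- Exact observability in infinite time:
`inf {∫_0^∞ ‖C T(t) x‖² dt : x ∈ D(A), ‖x‖ = 1} > 0`. -/
def IsInfiniteTimeExactlyObservable (A : X →ₗ.[ℂ] X) (C : A.domain →ₗ[ℂ] Y)
    (T : ℝ → X →L[ℂ] X) : Prop :=
  0 < ⨅ (x : X) (_ : x ∈ A.domain) (_ : ‖x‖ = 1), outputEnergy A C T x

end Observability

end

/-! Write `J_t = (1 + tA)⁻¹` and `E_t = J_t - J_t² = tA(1 + tA)⁻²`. The proof tests the lower bound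
on `C A^{-1/2}` at the vectors `E_t x`, which lie in `D(A) ∩ R(A)` whenever `x ∈ D(A)`, and
integrates its square against `dt/t`.

On the left stands a quadratic functional of `x`. It controls `‖x‖²`, because contraction semigroups
on a Hilbert space satisfy the square function estimate `‖x‖² ≤ 36 ∫ ‖E_t x‖² dt/t` when `R(A)` is
dense (`IsGenerator.norm_sq_le_lintegral_band`). This follows by integrating `t⁻¹ E_t²`, which has
an explicit primitive in `J_t`, and absorbing the adjoint part, bounded by accretivity.

On the right, Balakrishnan's formula with `s = σ/t` writes `t^{-1/2} C A^{-1/2} E_t x` as an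
integral over `σ` of outputs of products of resolvents (`IsGenerator.lintegral_balakrishnan_le`).
Each resolvent is a Laplace average of the semigroup, so each output has `L²(dt)` norm at most a
constant times that of `C T(t) x`, uniformly in `σ`
(`IsContractionSemigroup.lintegral_majorant_sq_le`), and the remaining weight in `σ` is integrable.

Together these give `‖x‖² ≤ κ ∫ ‖C T(t) x‖² dt` on all of `D(A)`, from which both conclusions are
read off. -/

noncomputable section

namespace Observability

open Set

/-! ### Resolvents as Laplace transforms of the semigroup. -/

section Resolvent

variable {X : Type*} [NormedAddCommGroup X] [InnerProductSpace ℂ X] {T : ℝ → X →L[ℂ] X}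
  {A : X →ₗ.[ℂ] X}

namespace IsContractionSemigroup

theorem norm_apply_le (hT : IsContractionSemigroup T) {t : ℝ} (ht : 0 ≤ t) (x : X) :
    ‖T t x‖ ≤ ‖x‖ :=
  (T t).le_of_opNorm_le (hT.norm_le_one t ht) x |>.trans_eq (one_mul _)

theorem add_apply (hT : IsContractionSemigroup T) {s t : ℝ} (hs : 0 ≤ s) (ht : 0 ≤ t) (x : X) :
    T (s + t) x = T s (T t x) := by
  rw [hT.map_add s t hs ht]; rfl

theorem apply_comm (hT : IsContractionSemigroup T) {s t : ℝ} (hs : 0 ≤ s) (ht : 0 ≤ t) (x : X) :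
    T s (T t x) = T t (T s x) := by
  rw [← hT.add_apply hs ht, ← hT.add_apply ht hs, add_comm]

/-- Extending the semigroup by the identity to negative times gives a jointly continuous map. -/
theorem continuous_apply (hT : IsContractionSemigroup T) :
    Continuous fun p : ℝ × X => T (max p.1 0) p.2 := by
  refine continuous_prod_of_continuous_lipschitzWith' _ 1 (fun t => ?_) fun x => ?_
  · refine LipschitzWith.of_dist_le_mul fun x y => ?_
    simpa [dist_eq_norm, ← map_sub] using hT.norm_apply_le (le_max_right t 0) (x - y)
  · exact (hT.continuousOn x).comp_continuous (by fun_prop) fun t => le_max_right t 0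

theorem continuous_orbit (hT : IsContractionSemigroup T) (x : X) :
    Continuous fun t : ℝ => T (max t 0) x :=
  hT.continuous_apply.comp (by fun_prop : Continuous fun t : ℝ => (t, x))

theorem integrable_exp_smul (hT : IsContractionSemigroup T) (t : ℝ) (x : X) :
    IntegrableOn (fun u => Real.exp (-u) • T (max (t * u) 0) x) (Ioi 0) := by
  refine Integrable.mono' ((integrableOn_exp_neg_Ioi 0).mul_const ‖x‖)
    (Continuous.aestronglyMeasurable ?_) (ae_of_all _ fun u => ?_)
  · exact (by fun_prop : Continuous fun u : ℝ => Real.exp (-u)).smul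
      ((hT.continuous_orbit x).comp (by fun_prop : Continuous fun u : ℝ => t * u))
  · rw [norm_smul, Real.norm_eq_abs, abs_of_pos (Real.exp_pos _)]
    gcongr
    exact hT.norm_apply_le (le_max_right _ _) x

theorem norm_integral_exp_smul_le (hT : IsContractionSemigroup T) (t : ℝ) (x : X) :
    ‖∫ u in Ioi (0 : ℝ), Real.exp (-u) • T (max (t * u) 0) x‖ ≤ ‖x‖ := by
  refine (norm_integral_le_of_norm_le ((integrableOn_exp_neg_Ioi 0).mul_const ‖x‖)
    (ae_of_all _ fun u => ?_)).trans_eq ?_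
  · rw [norm_smul, Real.norm_eq_abs, abs_of_pos (Real.exp_pos _)]
    gcongr
    exact hT.norm_apply_le (le_max_right _ _) x
  · rw [integral_mul_const, integral_exp_neg_Ioi_zero, one_mul]

/-- For `t ≥ 0` this is `(1 + t A)⁻¹`, where `-A` is the generator of `T`, given by the Laplace
transform `x ↦ ∫_0^∞ e^{-u} T(t u) x du`. -/
def res (hT : IsContractionSemigroup T) (t : ℝ) : X →L[ℂ] X :=
  LinearMap.mkContinuous
    { toFun := fun x => ∫ u in Ioi (0 : ℝ), Real.exp (-u) • T (max (t * u) 0) x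
      map_add' := fun x y => by
        rw [← integral_add (hT.integrable_exp_smul t x) (hT.integrable_exp_smul t y)]
        simp only [_root_.map_add, smul_add]
      map_smul' := fun c x => by
        rw [RingHom.id_apply, ← integral_smul c]
        refine integral_congr_ae (ae_of_all _ fun u => ?_)
        simp only [map_smul]
        rw [smul_comm] }
    1 fun x => (hT.norm_integral_exp_smul_le t x).trans_eq (one_mul _).symm

variable (hT : IsContractionSemigroup T)

theorem res_apply (t : ℝ) (x : X) :
    hT.res t x = ∫ u in Ioi (0 : ℝ), Real.exp (-u) • T (max (t * u) 0) x := rfl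

theorem norm_res_le (t : ℝ) : ‖hT.res t‖ ≤ 1 :=
  LinearMap.mkContinuous_norm_le _ zero_le_one _

theorem norm_res_apply_le (t : ℝ) (x : X) : ‖hT.res t x‖ ≤ ‖x‖ :=
  hT.norm_integral_exp_smul_le t x

theorem continuous_res : Continuous fun p : ℝ × X => hT.res p.1 p.2 := by
  refine continuous_prod_of_continuous_lipschitzWith' _ 1 (fun t => ?_) fun x => ?_
  · refine LipschitzWith.of_dist_le_mul fun x y => ?_
    simpa [dist_eq_norm, ← map_sub] using hT.norm_res_apply_le t (x - y)
  · refine continuous_of_dominated (bound := fun u => Real.exp (-u) * ‖x‖)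
      (fun t => (hT.integrable_exp_smul t x).aestronglyMeasurable)
      (fun t => ae_of_all _ fun u => ?_) ((integrableOn_exp_neg_Ioi 0).mul_const ‖x‖)
      (ae_of_all _ fun u => ?_)
    · rw [norm_smul, Real.norm_eq_abs, abs_of_pos (Real.exp_pos _)]
      gcongr
      exact hT.norm_apply_le (le_max_right _ _) x
    · exact ((hT.continuous_orbit x).comp
        (by fun_prop : Continuous fun t : ℝ => t * u)).const_smul _

theorem continuous_res_comp {α : Type*} [TopologicalSpace α] {f : α → ℝ} {g : α → X}
    (hf : Continuous f) (hg : Continuous g) : Continuous fun a => hT.res (f a) (g a) :=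
  hT.continuous_res.comp (hf.prodMk hg)

variable [CompleteSpace X]

theorem res_zero (x : X) : hT.res 0 x = x := by
  rw [res_apply]
  simp only [zero_mul, max_self, hT.map_zero, ContinuousLinearMap.id_apply]
  rw [integral_smul_const, integral_exp_neg_Ioi_zero, one_smul]

theorem apply_res {s : ℝ} (hs : 0 ≤ s) (t : ℝ) (x : X) :
    T s (hT.res t x) = hT.res t (T s x) := by
  rw [res_apply, res_apply, ← ContinuousLinearMap.integral_comp_comm _ (hT.integrable_exp_smul t x)]
  refine integral_congr_ae (ae_of_all _ fun u => ?_)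
  simp only [ContinuousLinearMap.map_smul_of_tower]
  rw [hT.apply_comm hs (le_max_right _ _)]

theorem res_comm (s t : ℝ) (x : X) : hT.res s (hT.res t x) = hT.res t (hT.res s x) := by
  conv_rhs => rw [res_apply _ s,
    ← ContinuousLinearMap.integral_comp_comm _ (hT.integrable_exp_smul s x)]
  rw [res_apply _ s]
  refine integral_congr_ae (ae_of_all _ fun u => ?_)
  simp only [ContinuousLinearMap.map_smul_of_tower]
  rw [hT.apply_res (le_max_right _ _)]

/-- Translating the Laplace integral by `h / t` confines the dependence on `h` to an exponential and
an integral over `[0, h/t]`, so the right derivative at `h = 0` can be computed by the fundamental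
theorem of calculus. -/
theorem apply_res_eq {t h : ℝ} (ht : 0 < t) (hh : 0 ≤ h) (x : X) :
    T h (hT.res t x) = Real.exp (h / t) •
      (hT.res t x - ∫ u in (0 : ℝ)..(h / t), Real.exp (-u) • T (max (t * u) 0) x) := by
  have hq : 0 ≤ h / t := div_nonneg hh ht.le
  have hint := hT.integrable_exp_smul t x
  have hsub : hT.res t x - ∫ u in (0 : ℝ)..(h / t), Real.exp (-u) • T (max (t * u) 0) x
      = ∫ u in Ioi (h / t), Real.exp (-u) • T (max (t * u) 0) x := by
    rw [res_apply, sub_eq_iff_eq_add', intervalIntegral.integral_interval_add_Ioi hint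
      (hint.mono_set (Ioi_subset_Ioi hq))]
  have hshift := (measurePreserving_add_right volume (h / t)).setIntegral_preimage_emb
    (measurableEmbedding_addRight (h / t)) (fun u => Real.exp (-u) • T (max (t * u) 0) x)
    (Ioi (h / t))
  rw [preimage_add_const_Ioi, sub_self] at hshift
  rw [hsub, ← hshift, ← integral_smul, res_apply,
    ← ContinuousLinearMap.integral_comp_comm _ hint]
  refine setIntegral_congr_fun measurableSet_Ioi fun u hu => ?_
  have hu' : 0 ≤ t * u := mul_nonneg ht.le (le_of_lt hu)
  have e : t * (u + h / t) = h + t * u := by field_simp; ring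
  simp only [ContinuousLinearMap.map_smul_of_tower]
  rw [e, max_eq_left hu', max_eq_left (add_nonneg hh hu'), hT.add_apply hh hu', smul_smul,
    ← Real.exp_add]
  congr 2
  ring

theorem tendsto_slope_res {t : ℝ} (ht : 0 < t) (x : X) :
    Tendsto (fun h : ℝ => h⁻¹ • (T h (hT.res t x) - hT.res t x)) (𝓝[>] 0)
      (𝓝 (t⁻¹ • (hT.res t x - x))) := by
  have hf : Continuous fun u : ℝ => Real.exp (-u) • T (max (t * u) 0) x :=
    (by fun_prop : Continuous fun u : ℝ => Real.exp (-u)).smul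
      ((hT.continuous_orbit x).comp (by fun_prop : Continuous fun u : ℝ => t * u))
  have h1 : HasDerivAt (fun q : ℝ => ∫ u in (0 : ℝ)..q, Real.exp (-u) • T (max (t * u) 0) x)
      x 0 := by
    simpa [hT.map_zero] using intervalIntegral.integral_hasDerivAt_right
      (hf.intervalIntegrable 0 0) hf.stronglyMeasurable.stronglyMeasurableAtFilter hf.continuousAt
  have h2 := (Real.hasDerivAt_exp 0).fun_smul (h1.const_sub (hT.res t x))
  have h3 : HasDerivAt (fun h : ℝ => h / t) t⁻¹ 0 := by
    simpa using (hasDerivAt_id (0 : ℝ)).div_const t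
  have h4 := HasDerivAt.scomp_of_eq (0 : ℝ) h2 h3 (by simp)
  have h5 := (hasDerivAt_iff_tendsto_slope_zero.1 h4).mono_left
    (nhdsWithin_mono (0 : ℝ) fun h (hh : 0 < h) => hh.ne')
  simp only [Real.exp_zero, one_smul, intervalIntegral.integral_same, sub_zero,
    neg_add_eq_sub, zero_add, Function.comp_apply, zero_div] at h5
  refine h5.congr' ?_
  filter_upwards [self_mem_nhdsWithin] with h hh
  rw [hT.apply_res_eq ht (le_of_lt hh)]

end IsContractionSemigroup

theorem IsGenerator.mem_graph (hA : IsGenerator T (-A)) {x y : X} :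
    (x, y) ∈ A.graph ↔ Tendsto (fun t : ℝ => t⁻¹ • (T t x - x)) (𝓝[>] 0) (𝓝 (-y)) := by
  rw [← hA]
  simp only [LinearPMap.mem_graph_iff, LinearPMap.neg_apply, neg_inj]
  rfl

theorem graph_unique {x y z : X} (hy : (x, y) ∈ A.graph) (hz : (x, z) ∈ A.graph) : y = z := by
  rw [LinearPMap.mem_graph_iff] at hy hz
  obtain ⟨a, ha, rfl⟩ := hy
  obtain ⟨b, hb, rfl⟩ := hz
  rw [Subtype.ext (ha.trans hb.symm)]

/-- `A` is accretive. -/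
theorem IsGenerator.re_inner_nonneg (hT : IsContractionSemigroup T) (hA : IsGenerator T (-A))
    {x y : X} (h : (x, y) ∈ A.graph) : 0 ≤ (inner ℂ x y).re := by
  have h1 := (hA.mem_graph).1 h
  have h2 : Tendsto (fun t : ℝ => (inner ℂ x (t⁻¹ • (T t x - x))).re) (𝓝[>] 0)
      (𝓝 (inner ℂ x (-y)).re) :=
    (Complex.continuous_re.tendsto _).comp (tendsto_const_nhds.inner h1)
  have h3 : (inner ℂ x (-y)).re ≤ 0 := by
    refine le_of_tendsto h2 ?_
    filter_upwards [self_mem_nhdsWithin] with t ht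
    have ht' : (0 : ℝ) < t := ht
    have e : (inner ℂ x (t⁻¹ • (T t x - x))).re = t⁻¹ * ((inner ℂ x (T t x)).re - ‖x‖ ^ 2) := by
      rw [← Complex.coe_smul, inner_smul_right, inner_sub_right, Complex.re_ofReal_mul,
        Complex.sub_re, inner_self_eq_norm_sq_to_K]
      norm_cast
    rw [e]
    refine mul_nonpos_of_nonneg_of_nonpos (inv_nonneg.2 ht'.le) (sub_nonpos.2 ?_)
    calc (inner ℂ x (T t x)).re ≤ ‖x‖ * ‖T t x‖ := re_inner_le_norm (𝕜 := ℂ) x (T t x)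
      _ ≤ ‖x‖ * ‖x‖ := by gcongr; exact hT.norm_apply_le ht'.le x
      _ = ‖x‖ ^ 2 := (sq _).symm
  rw [inner_neg_right, Complex.neg_re] at h3
  linarith

section

variable [CompleteSpace X] (hT : IsContractionSemigroup T)

theorem IsGenerator.res_mem_graph (hA : IsGenerator T (-A)) {t : ℝ} (ht : 0 < t) (x : X) :
    (hT.res t x, t⁻¹ • (x - hT.res t x)) ∈ A.graph := by
  rw [hA.mem_graph, ← smul_neg, neg_sub]
  exact hT.tendsto_slope_res ht x

theorem IsGenerator.res_mem_domain (hA : IsGenerator T (-A)) {t : ℝ} (ht : 0 < t) (x : X) :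
    hT.res t x ∈ A.domain :=
  LinearPMap.mem_domain_of_mem_graph (hA.res_mem_graph hT ht x)

/-- The difference `d` of two solutions satisfies `A d = -t⁻¹ d`, and accretivity then forces `d =
0`. -/
theorem IsGenerator.eq_res (hA : IsGenerator T (-A)) {t : ℝ} (ht : 0 < t) {x y z : X}
    (hyz : (y, z) ∈ A.graph)
    (h : y + t • z = x) : y = hT.res t x := by
  have h1 := A.graph.sub_mem hyz (hA.res_mem_graph hT ht x)
  have h2 : z - t⁻¹ • (x - hT.res t x) = -(t⁻¹ • (y - hT.res t x)) := by
    rw [← h, ← smul_neg, eq_comm, ← sub_eq_zero]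
    have : t⁻¹ • t • z = z := by rw [smul_smul, inv_mul_cancel₀ ht.ne', one_smul]
    simp only [smul_sub, smul_add, smul_neg, this]
    abel
  have h3 := hA.re_inner_nonneg hT h1
  simp only at h3
  rw [h2, inner_neg_right, ← Complex.coe_smul, inner_smul_right, Complex.neg_re,
    Complex.re_ofReal_mul, inner_self_eq_norm_sq_to_K] at h3
  have h4 : t⁻¹ * ‖y - hT.res t x‖ ^ 2 ≤ 0 := by
    have : (((‖y - hT.res t x‖ : ℝ) : ℂ) ^ 2).re = ‖y - hT.res t x‖ ^ 2 := by norm_cast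
    simp only [Complex.coe_algebraMap] at h3
    rw [this] at h3
    linarith
  have h5 : ‖y - hT.res t x‖ ^ 2 ≤ 0 := nonpos_of_mul_nonpos_right h4 (inv_pos.2 ht)
  exact sub_eq_zero.1 (norm_eq_zero.1 (pow_eq_zero_iff two_ne_zero |>.1
    (le_antisymm h5 (sq_nonneg _))))

/-- `Function.invFun` returns a true preimage once one exists, which the Laplace transform supplies;
`eq_res` then identifies it. -/
theorem IsGenerator.resolventAt_eq (hA : IsGenerator T (-A)) {s : ℝ} (hs : 0 < s) (x : X) :
    (resolventAt A s x : X) = s⁻¹ • hT.res s⁻¹ x := by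
  have hmem := A.graph.smul_mem ((s⁻¹ : ℝ) : ℂ) (hA.res_mem_graph hT (inv_pos.2 hs) x)
  rw [Prod.smul_mk, Complex.coe_smul, Complex.coe_smul, smul_smul, inv_inv,
    inv_mul_cancel₀ hs.ne', one_smul, LinearPMap.mem_graph_iff] at hmem
  obtain ⟨y, hy, hAy⟩ := hmem
  have hex : ∃ y : A.domain, s • (y : X) + A y = x := by
    refine ⟨y, ?_⟩
    rw [hy, hAy, smul_smul, mul_inv_cancel₀ hs.ne', one_smul, add_sub_cancel]
  have hinv : s • (resolventAt A s x : X) + A (resolventAt A s x) = x :=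
    Function.invFun_eq (f := fun y : A.domain => s • (y : X) + A y) hex
  have hgr : ((resolventAt A s x : X), A (resolventAt A s x)) ∈ A.graph := A.mem_graph _
  have key := hA.eq_res hT (inv_pos.2 hs) (x := s⁻¹ • x) hgr (by
    conv_rhs => rw [← hinv]
    rw [smul_add, smul_smul, inv_mul_cancel₀ hs.ne', one_smul])
  rw [key, ContinuousLinearMap.map_smul_of_tower]

theorem IsGenerator.re_inner_res_nonneg (hA : IsGenerator T (-A)) {t : ℝ} (ht : 0 < t) (x : X) :
    0 ≤ (inner ℂ (hT.res t x) (x - hT.res t x)).re := by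
  have h := hA.re_inner_nonneg hT (hA.res_mem_graph hT ht x)
  rw [← Complex.coe_smul, inner_smul_right, Complex.re_ofReal_mul] at h
  exact nonneg_of_mul_nonneg_right h (inv_pos.2 ht)

/-- The resolvent identity. -/
theorem IsGenerator.smul_res_sub (hA : IsGenerator T (-A)) {s t : ℝ} (hs : 0 < s) (ht : 0 < t) (x : X) :
    s • (hT.res s x - hT.res s (hT.res t x)) = t • (hT.res t x - hT.res s (hT.res t x)) := by
  have h1 := hA.res_mem_graph hT hs (hT.res t x)
  have h2 := hA.res_mem_graph hT ht (hT.res s x)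
  rw [hT.res_comm t s] at h2
  have h3 := graph_unique h1 h2
  have h4 := congrArg (fun v => (s * t) • v) h3
  simp only [smul_smul] at h4
  rw [mul_inv_cancel_right₀ ht.ne', mul_comm s t, mul_inv_cancel_right₀ hs.ne'] at h4
  exact h4.symm

/-- The resolvent identity reads `J_s - J_t = s⁻¹ (s - t) (J_s J_t - J_t)`. With `‖J_s‖ ≤ 1` this
gives norm continuity at `t`, and dividing by `s - t` then gives the derivative. -/
theorem IsGenerator.hasDerivAt_res (hA : IsGenerator T (-A)) {t : ℝ} (ht : 0 < t) :
    HasDerivAt hT.res (-(t⁻¹ • (hT.res t - hT.res t * hT.res t))) t := by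
  have hpos : ∀ᶠ s in 𝓝 t, 0 < s := lt_mem_nhds ht
  have hid : ∀ s, 0 < s → hT.res s - hT.res t =
      (s⁻¹ * (s - t)) • (hT.res s * hT.res t - hT.res t) := by
    intro s hs
    ext x
    have h := hA.smul_res_sub hT hs ht x
    have h' : s • (hT.res s x - hT.res t x) =
        (s - t) • (hT.res s (hT.res t x) - hT.res t x) := by
      have : s • hT.res s x = s • hT.res s (hT.res t x) +
          t • (hT.res t x - hT.res s (hT.res t x)) := by
        rw [← h]; simp only [smul_sub]; abel
      rw [smul_sub, this]
      simp only [smul_sub, sub_smul]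
      abel
    have h'' := congrArg (fun v => s⁻¹ • v) h'
    simp only [smul_smul, inv_mul_cancel₀ hs.ne', one_smul] at h''
    exact h''
  have hcont : Tendsto hT.res (𝓝 t) (𝓝 (hT.res t)) := by
    rw [tendsto_iff_norm_sub_tendsto_zero]
    have hlim : Tendsto (fun s : ℝ => |s⁻¹ * (s - t)| * 2) (𝓝 t) (𝓝 0) := by
      have : Tendsto (fun s : ℝ => |s⁻¹ * (s - t)| * 2) (𝓝 t) (𝓝 (|t⁻¹ * (t - t)| * 2)) :=
        (((tendsto_inv₀ ht.ne').mul (tendsto_id.sub_const t)).abs).mul_const 2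
      simpa using this
    refine squeeze_zero' (Eventually.of_forall fun s => norm_nonneg _) ?_ hlim
    filter_upwards [hpos] with s hs
    rw [hid s hs, norm_smul, Real.norm_eq_abs]
    gcongr
    calc ‖hT.res s * hT.res t - hT.res t‖ ≤ ‖hT.res s‖ * ‖hT.res t‖ + ‖hT.res t‖ :=
          (norm_sub_le _ _).trans (by gcongr; exact norm_mul_le _ _)
      _ ≤ 1 * 1 + 1 := by gcongr <;> exact hT.norm_res_le _
      _ = 2 := by norm_num
  rw [hasDerivAt_iff_tendsto_slope]
  have h1 : Tendsto (fun s => s⁻¹ • (hT.res s * hT.res t - hT.res t)) (𝓝 t)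
      (𝓝 (t⁻¹ • (hT.res t * hT.res t - hT.res t))) :=
    (tendsto_inv₀ ht.ne').smul ((hcont.mul_const _).sub_const _)
  rw [← smul_neg, neg_sub]
  refine (h1.mono_left nhdsWithin_le_nhds).congr' ?_
  filter_upwards [self_mem_nhdsWithin, nhdsWithin_le_nhds hpos] with s hs hs0
  have hne : s - t ≠ 0 := sub_ne_zero.2 hs
  rw [slope_def_module, hid s hs0, smul_smul]
  congr 1
  field_simp

/-- On the range `J_t A y = t⁻¹ (y - J_t y)` decays; contractivity of `J_t` extends this to the
closure. -/
theorem IsGenerator.tendsto_res_atTop (hA : IsGenerator T (-A)) (hdense : Dense (opRange A : Set X)) (x : X) :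
    Tendsto (fun t => hT.res t x) atTop (𝓝 0) := by
  rw [Metric.tendsto_nhds]
  intro ε hε
  obtain ⟨_, hz, y, rfl⟩ := Metric.dense_iff.1 hdense x (ε / 2) (half_pos hε)
  have hlim : Tendsto (fun t : ℝ => t⁻¹ * (2 * ‖(y : X)‖)) atTop (𝓝 0) := by
    simpa using tendsto_inv_atTop_zero.mul_const (2 * ‖(y : X)‖)
  filter_upwards [hlim.eventually (gt_mem_nhds (half_pos hε)), eventually_gt_atTop 0]
    with t ht ht0
  have h1 : hT.res t (A y) = t⁻¹ • ((y : X) - hT.res t y) := by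
    have h2 : (y : X) = hT.res t ((y : X) + t • A y) := hA.eq_res hT ht0 (A.mem_graph y) rfl
    have h3 : t • hT.res t (A y) = (y : X) - hT.res t y := by
      rw [map_add, ContinuousLinearMap.map_smul_of_tower] at h2
      exact eq_sub_of_add_eq' h2.symm
    rw [← h3, smul_smul, inv_mul_cancel₀ ht0.ne', one_smul]
  have h2 : ‖hT.res t (A y)‖ < ε / 2 := by
    refine lt_of_le_of_lt ?_ ht
    rw [h1, norm_smul, Real.norm_eq_abs, abs_of_pos (inv_pos.2 ht0)]
    gcongr
    linarith [norm_sub_le (y : X) (hT.res t y), hT.norm_res_apply_le t (y : X)]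
  rw [dist_zero_right]
  calc ‖hT.res t x‖ = ‖hT.res t (x - A y) + hT.res t (A y)‖ := by rw [← map_add, sub_add_cancel]
    _ ≤ ‖x - A y‖ + ‖hT.res t (A y)‖ :=
      (norm_add_le _ _).trans (by gcongr; exact hT.norm_res_apply_le _ _)
    _ < ε / 2 + ε / 2 := by
      gcongr
      rw [← dist_eq_norm, dist_comm]
      exact hz
    _ = ε := add_halves ε

end

end Resolvent

/-! ### The square function estimate for `E_t`. -/

section SquareFunction

variable {X : Type*} [NormedAddCommGroup X] [InnerProductSpace ℂ X] {T : ℝ → X →L[ℂ] X}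
  {A : X →ₗ.[ℂ] X}

/-- For `t ≥ 0` this is `t A (1 + t A)⁻²`, where `-A` is the generator of `T`. -/
def IsContractionSemigroup.band (hT : IsContractionSemigroup T) (t : ℝ) : X →L[ℂ] X :=
  hT.res t - hT.res t * hT.res t

theorem IsContractionSemigroup.band_apply (hT : IsContractionSemigroup T) (t : ℝ) (x : X) :
    hT.band t x = hT.res t x - hT.res t (hT.res t x) := rfl

theorem IsContractionSemigroup.continuous_band (hT : IsContractionSemigroup T) (x : X) :
    Continuous fun t => hT.band t x :=
  have h : Continuous fun t => hT.res t x := hT.continuous_res_comp continuous_id continuous_const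
  h.sub (hT.continuous_res_comp continuous_id h)

/-- The functional `S ↦ Re ⟨x, S x⟩`. -/
def reForm (x : X) : (X →L[ℂ] X) →L[ℝ] ℝ :=
  Complex.reCLM.comp
    (((innerSL ℂ x).comp (ContinuousLinearMap.apply ℂ X x)).restrictScalars ℝ)

variable (hT : IsContractionSemigroup T)

/-- The scalar primitive `⟨x, (J³/3 - J²/2) x⟩`, with `J = (1 + t A)⁻¹`, of `t⁻¹ ⟨x, E² x⟩`, with
`E = t A (1 + t A)⁻²`. -/
def IsContractionSemigroup.primitive (hT : IsContractionSemigroup T) (x : X) (t : ℝ) : ℝ :=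
  3⁻¹ * (inner ℂ x (hT.res t (hT.res t (hT.res t x)))).re -
    2⁻¹ * (inner ℂ x (hT.res t (hT.res t x))).re

theorem IsContractionSemigroup.continuous_primitive (x : X) : Continuous (hT.primitive x) := by
  have h1 : Continuous fun t => hT.res t x := hT.continuous_res_comp continuous_id continuous_const
  have h2 := hT.continuous_res_comp continuous_id h1
  have h3 := hT.continuous_res_comp continuous_id h2
  exact ((Complex.continuous_re.comp (continuous_const.inner h3)).const_mul _).sub
    ((Complex.continuous_re.comp (continuous_const.inner h2)).const_mul _)

variable [CompleteSpace X]

/-- Expand `1 = ((1 - J) + J)² = (1 - J)² + 2E + J²` and pair with `E x`. Accretivity applied to `J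
(1 - J) x` and to `J (J x)` makes the first and last terms nonnegative. -/
theorem IsGenerator.norm_band_sq_le (hA : IsGenerator T (-A)) {t : ℝ} (ht : 0 < t) (x : X) :
    2 * ‖hT.band t x‖ ^ 2 ≤ (inner ℂ x (hT.band t x)).re := by
  have h1 := hA.re_inner_res_nonneg hT ht (hT.res t x)
  have h2 := hA.re_inner_res_nonneg hT ht (x - hT.res t x)
  rw [map_sub, ← hT.band_apply] at h2
  rw [← hT.band_apply] at h1
  have e : x = (x - hT.res t x - hT.band t x) + (2 : ℂ) • hT.band t x
      + hT.res t (hT.res t x) := by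
    rw [hT.band_apply, two_smul]; abel
  have h3 : (inner ℂ (hT.band t x) (hT.res t (hT.res t x))).re =
      (inner ℂ (hT.res t (hT.res t x)) (hT.band t x)).re := inner_re_symm (𝕜 := ℂ) _ _
  have h4 : (inner ℂ (hT.band t x) ((2 : ℂ) • hT.band t x)).re = 2 * ‖hT.band t x‖ ^ 2 := by
    rw [inner_smul_right, inner_self_eq_norm_sq_to_K]
    simp [← Complex.ofReal_pow]
  have h5 := congrArg (fun v => (inner ℂ (hT.band t x) v).re) e
  have h6 : (inner ℂ x (hT.band t x)).re = (inner ℂ (hT.band t x) x).re :=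
    inner_re_symm (𝕜 := ℂ) _ _
  rw [h6, h5, inner_add_right, inner_add_right, Complex.add_re, Complex.add_re, h3, h4]
  linarith

/-- A reformulation of `norm_band_sq_le` that is stable under adjoints. -/
theorem IsGenerator.norm_four_smul_band_sub_one_le (hA : IsGenerator T (-A)) {t : ℝ}
    (ht : 0 < t) : ‖(4 : ℂ) • hT.band t - 1‖ ≤ 1 := by
  refine ContinuousLinearMap.opNorm_le_bound _ zero_le_one fun x => ?_
  rw [one_mul]
  refine le_of_sq_le_sq ?_ (norm_nonneg _)
  have h := hA.norm_band_sq_le hT ht x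
  have e := norm_sub_sq (𝕜 := ℂ) ((4 : ℂ) • hT.band t x) x
  rw [norm_smul, inner_smul_left] at e
  have e2 : (RCLike.re ((starRingEnd ℂ) 4 * inner ℂ (hT.band t x) x) : ℝ) =
      4 * (inner ℂ x (hT.band t x)).re := by
    have := inner_re_symm (𝕜 := ℂ) x (hT.band t x)
    simp only [RCLike.re_to_complex] at this
    simp [this]
  rw [e2] at e
  have e3 : ((4 : ℂ) • hT.band t - 1) x = (4 : ℂ) • hT.band t x - x := rfl
  rw [e3, e]
  norm_num
  nlinarith

theorem IsGenerator.norm_adjoint_band_sq_le (hA : IsGenerator T (-A)) {t : ℝ} (ht : 0 < t)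
    (x : X) :
    2 * ‖(hT.band t).adjoint x‖ ^ 2 ≤ (inner ℂ x (hT.band t x)).re := by
  have h := ((4 : ℂ) • hT.band t - 1).adjoint.le_of_opNorm_le
    ((LinearIsometryEquiv.norm_map _ _).trans_le (hA.norm_four_smul_band_sub_one_le hT ht)) x
  have e1 : ((4 : ℂ) • hT.band t - 1).adjoint x = (4 : ℂ) • (hT.band t).adjoint x - x := by
    have h1 : (1 : X →L[ℂ] X).adjoint = 1 := star_one (X →L[ℂ] X)
    have h4 : ((4 : ℂ) • hT.band t).adjoint = (4 : ℂ) • (hT.band t).adjoint := by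
      rw [map_smulₛₗ, map_ofNat]
    rw [map_sub, h1, h4]
    rfl
  rw [e1, one_mul] at h
  have e := norm_sub_sq (𝕜 := ℂ) ((4 : ℂ) • (hT.band t).adjoint x) x
  rw [norm_smul, inner_smul_left, ContinuousLinearMap.adjoint_inner_left] at e
  have e2 : (RCLike.re ((starRingEnd ℂ) 4 * inner ℂ x (hT.band t x)) : ℝ) =
      4 * (inner ℂ x (hT.band t x)).re := by
    simp
  rw [e2] at e
  have h' : ‖(4 : ℂ) • (hT.band t).adjoint x - x‖ ^ 2 ≤ ‖x‖ ^ 2 := by gcongr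
  rw [e] at h'
  norm_num at h'
  nlinarith

/-- Norm continuity of `E_t` is used here, since taking adjoints does not preserve strong
continuity. -/
theorem IsGenerator.continuousOn_norm_adjoint_band (hA : IsGenerator T (-A)) (x : X) :
    ContinuousOn (fun t => ‖(hT.band t).adjoint x‖) (Ioi 0) := by
  intro t ht
  have h1 := (hA.hasDerivAt_res hT ht).continuousAt
  have h2 : ContinuousAt hT.band t := h1.sub (h1.mul h1)
  have h3 : ContinuousAt (fun s => (hT.band s).adjoint) t :=
    (LinearIsometryEquiv.continuous _).continuousAt.comp h2
  exact (h3.clm_apply continuousAt_const).norm.continuousWithinAt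

/-- The integrand is at most half of `t⁻¹ Re ⟨x, E_t x⟩`, the derivative of `-Re ⟨x, J_t x⟩`, whose
total change is at most `2‖x‖²`. -/
theorem IsGenerator.integral_norm_adjoint_band_sq_le (hA : IsGenerator T (-A)) {a b : ℝ}
    (ha : 0 < a) (hab : a ≤ b) (x : X) :
    ∫ t in a..b, t⁻¹ * ‖(hT.band t).adjoint x‖ ^ 2 ≤ ‖x‖ ^ 2 := by
  have hpos : ∀ t ∈ uIcc a b, 0 < t := fun t ht => by
    rw [uIcc_of_le hab] at ht; exact ha.trans_le ht.1
  have hinv : ContinuousOn (fun t : ℝ => t⁻¹) (uIcc a b) :=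
    continuousOn_inv₀.mono fun t ht => (hpos t ht).ne'
  have hband : Continuous fun t => (inner ℂ x (hT.band t x)).re :=
    Complex.continuous_re.comp (continuous_const.inner (hT.continuous_band x))
  have hd : ∀ t ∈ uIcc a b, HasDerivAt (fun t => -(inner ℂ x (hT.res t x)).re)
      (t⁻¹ * (inner ℂ x (hT.band t x)).re) t := by
    intro t ht
    have h1 := (reForm x).hasFDerivAt.comp_hasDerivAt t (hA.hasDerivAt_res hT (hpos t ht))
    refine h1.neg.congr_deriv ?_
    rw [map_neg, neg_neg, map_smul]
    rfl
  have hint := intervalIntegral.integral_eq_sub_of_hasDerivAt hd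
    (hinv.mul hband.continuousOn).intervalIntegrable
  have hle : ∫ t in a..b, t⁻¹ * ‖(hT.band t).adjoint x‖ ^ 2 ≤
      ∫ t in a..b, 2⁻¹ * (t⁻¹ * (inner ℂ x (hT.band t x)).re) := by
    refine intervalIntegral.integral_mono_on hab
      (hinv.mul (((hA.continuousOn_norm_adjoint_band hT x).mono hpos).pow 2)).intervalIntegrable
      ((hinv.mul hband.continuousOn).const_mul _ |>.intervalIntegrable) fun t ht => ?_
    have ht' : 0 < t := ha.trans_le ht.1
    have := hA.norm_adjoint_band_sq_le hT ht' x
    have h3 : ‖(hT.band t).adjoint x‖ ^ 2 ≤ 2⁻¹ * (inner ℂ x (hT.band t x)).re := by linarith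
    calc t⁻¹ * ‖(hT.band t).adjoint x‖ ^ 2 ≤ t⁻¹ * (2⁻¹ * (inner ℂ x (hT.band t x)).re) := by
          gcongr
      _ = _ := by ring
  rw [intervalIntegral.integral_const_mul, hint] at hle
  have hb : ∀ t, |(inner ℂ x (hT.res t x)).re| ≤ ‖x‖ ^ 2 := fun t =>
    calc |(inner ℂ x (hT.res t x)).re| ≤ ‖x‖ * ‖hT.res t x‖ :=
          (Complex.abs_re_le_norm _).trans (norm_inner_le_norm _ _)
      _ ≤ ‖x‖ * ‖x‖ := by gcongr; exact hT.norm_res_apply_le t x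
      _ = ‖x‖ ^ 2 := (sq _).symm
  have := (abs_le.1 (hb a)).2
  have := (abs_le.1 (hb b)).1
  linarith

/-- Since `J' = -t⁻¹ E` and everything commutes, `(J³/3 - J²/2)' = (J² - J) J' = t⁻¹ E²`. -/
theorem IsGenerator.hasDerivAt_primitive (hA : IsGenerator T (-A)) {t : ℝ} (ht : 0 < t) (x : X) :
    HasDerivAt (hT.primitive x) (t⁻¹ * (inner ℂ ((hT.band t).adjoint x) (hT.band t x)).re) t := by
  have h1 := hA.hasDerivAt_res hT ht
  have h2 := h1.mul h1
  have h3 := (((h1.mul h2).const_smul (3⁻¹ : ℝ)).sub (h2.const_smul (2⁻¹ : ℝ))).congr_deriv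
    (g' := t⁻¹ • (hT.band t * hT.band t)) (by
      simp only [IsContractionSemigroup.band, Pi.mul_apply, mul_sub, sub_mul, mul_assoc, neg_mul,
        mul_neg, smul_mul_assoc, mul_smul_comm, mul_add]
      module)
  have h4 : hT.primitive x = reForm x ∘
      ((3⁻¹ : ℝ) • (hT.res * (hT.res * hT.res)) - (2⁻¹ : ℝ) • (hT.res * hT.res)) := by
    funext s
    simp only [Function.comp_apply, Pi.sub_apply, Pi.smul_apply, map_sub, map_smul]
    rfl
  rw [h4]
  refine ((reForm x).hasFDerivAt.comp_hasDerivAt t h3).congr_deriv ?_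
  rw [map_smul, ContinuousLinearMap.adjoint_inner_left]
  rfl

theorem IsContractionSemigroup.primitive_zero (x : X) : hT.primitive x 0 = -(6⁻¹ * ‖x‖ ^ 2) := by
  have : (inner ℂ x x).re = ‖x‖ ^ 2 := by
    rw [inner_self_eq_norm_sq_to_K]; norm_cast
  rw [primitive, hT.res_zero, hT.res_zero, hT.res_zero, this]
  ring

theorem IsGenerator.tendsto_primitive_atTop (hA : IsGenerator T (-A))
    (hdense : Dense (opRange A : Set X)) (x : X) :
    Tendsto (hT.primitive x) atTop (𝓝 0) := by
  have h1 := hA.tendsto_res_atTop hT hdense x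
  have h2 : Tendsto (fun t => hT.res t (hT.res t x)) atTop (𝓝 0) :=
    squeeze_zero_norm (fun t => hT.norm_res_apply_le _ _) (by simpa using h1.norm)
  have h3 : Tendsto (fun t => hT.res t (hT.res t (hT.res t x))) atTop (𝓝 0) :=
    squeeze_zero_norm (fun t => hT.norm_res_apply_le _ _) (by simpa using h2.norm)
  have k : ∀ f : ℝ → X, Tendsto f atTop (𝓝 0) →
      Tendsto (fun t => (inner ℂ x (f t)).re) atTop (𝓝 0) := fun f hf => by
    simpa [Function.comp_def] using (Complex.continuous_re.tendsto _).comp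
      ((tendsto_const_nhds (x := x)).inner (𝕜 := ℂ) hf)
  simpa [IsContractionSemigroup.primitive, Function.comp_def] using!
    ((k _ h3).const_mul (3⁻¹ : ℝ)).sub ((k _ h2).const_mul (2⁻¹ : ℝ))

/-- The lower square function estimate for `t A (1 + t A)⁻²`. -/
theorem IsGenerator.norm_sq_le_lintegral_band (hA : IsGenerator T (-A))
    (hdense : Dense (opRange A : Set X)) (x : X) :
    ENNReal.ofReal (‖x‖ ^ 2) ≤
      36 * ∫⁻ t in Ioi (0 : ℝ), ENNReal.ofReal (t⁻¹ * ‖hT.band t x‖ ^ 2) := by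
  set S := ∫⁻ t in Ioi (0 : ℝ), ENNReal.ofReal (t⁻¹ * ‖hT.band t x‖ ^ 2) with hS
  rcases eq_or_ne S ∞ with htop | htop
  · simp [htop]
  have hfin : ∀ a b : ℝ, 0 < a → a ≤ b →
      hT.primitive x b - hT.primitive x a ≤ 3 * S.toReal + 12⁻¹ * ‖x‖ ^ 2 := by
    intro a b ha hab
    have hpos : ∀ t ∈ uIcc a b, 0 < t := fun t ht => by
      rw [uIcc_of_le hab] at ht; exact ha.trans_le ht.1
    have hinv : ContinuousOn (fun t : ℝ => t⁻¹) (uIcc a b) :=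
      continuousOn_inv₀.mono fun t ht => (hpos t ht).ne'
    have hc1 : ContinuousOn (fun t => t⁻¹ * ‖hT.band t x‖ ^ 2) (uIcc a b) :=
      hinv.mul ((hT.continuous_band x).norm.pow 2).continuousOn
    have hc2 : ContinuousOn (fun t => t⁻¹ * ‖(hT.band t).adjoint x‖ ^ 2) (uIcc a b) :=
      hinv.mul (((hA.continuousOn_norm_adjoint_band hT x).mono hpos).pow 2)
    have hle : ∫ t in a..b, t⁻¹ * ‖hT.band t x‖ ^ 2 ≤ S.toReal := by
      rw [intervalIntegral.integral_of_le hab, integral_eq_lintegral_of_nonneg_ae]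
      · refine ENNReal.toReal_mono htop (lintegral_mono_set fun t ht => ha.trans ht.1)
      · filter_upwards [ae_restrict_mem measurableSet_Ioc] with t ht
        have : 0 < t := ha.trans ht.1
        positivity
      · rw [uIcc_of_le hab] at hc1
        exact (hc1.mono Ioc_subset_Icc_self).aestronglyMeasurable measurableSet_Ioc
    have hsub : hT.primitive x b - hT.primitive x a ≤ ∫ t in a..b,
        (3 * (t⁻¹ * ‖hT.band t x‖ ^ 2) + 12⁻¹ * (t⁻¹ * ‖(hT.band t).adjoint x‖ ^ 2)) := by
      have hii := ((hc1.const_mul 3).add (hc2.const_mul 12⁻¹))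
      refine intervalIntegral.sub_le_integral_of_hasDeriv_right_of_le hab
        (hT.continuous_primitive x).continuousOn
        (fun t ht => (hA.hasDerivAt_primitive hT (ha.trans ht.1) x).hasDerivWithinAt)
        ?_ fun t ht => ?_
      · rw [uIcc_of_le hab] at hii
        exact hii.integrableOn_Icc
      · have ht' : 0 < t := ha.trans ht.1
        have h1 : (inner ℂ ((hT.band t).adjoint x) (hT.band t x)).re ≤
            ‖(hT.band t).adjoint x‖ * ‖hT.band t x‖ := re_inner_le_norm (𝕜 := ℂ) _ _
        -- The total increment of the primitive is `‖x‖²/6`. The coefficient `1/12` lets the adjoint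
        -- term absorb half of it; `3` is then what Young's inequality requires, as `4 · 3 · (1/12)
        -- = 1`.
        have h2 : (inner ℂ ((hT.band t).adjoint x) (hT.band t x)).re ≤
            3 * ‖hT.band t x‖ ^ 2 + 12⁻¹ * ‖(hT.band t).adjoint x‖ ^ 2 := by
          nlinarith [sq_nonneg (6 * ‖hT.band t x‖ - ‖(hT.band t).adjoint x‖)]
        calc _ ≤ t⁻¹ * (3 * ‖hT.band t x‖ ^ 2 + 12⁻¹ * ‖(hT.band t).adjoint x‖ ^ 2) := by gcongr
          _ = _ := by ring
    rw [intervalIntegral.integral_add (hc1.const_mul 3).intervalIntegrable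
      (hc2.const_mul 12⁻¹).intervalIntegrable, intervalIntegral.integral_const_mul,
      intervalIntegral.integral_const_mul] at hsub
    have := hA.integral_norm_adjoint_band_sq_le hT ha hab x
    linarith
  have hzero : ∀ b : ℝ, 0 < b →
      hT.primitive x b + 6⁻¹ * ‖x‖ ^ 2 ≤ 3 * S.toReal + 12⁻¹ * ‖x‖ ^ 2 := by
    intro b hb
    have h1 : Tendsto (fun a => hT.primitive x b - hT.primitive x a) (𝓝[>] 0)
        (𝓝 (hT.primitive x b - hT.primitive x 0)) :=
      (tendsto_const_nhds.sub ((hT.continuous_primitive x).tendsto 0)).mono_left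
        nhdsWithin_le_nhds
    rw [hT.primitive_zero, sub_neg_eq_add] at h1
    refine le_of_tendsto h1 ?_
    filter_upwards [Ioc_mem_nhdsGT hb] with a ha using hfin a b ha.1 ha.2
  have hlim : 6⁻¹ * ‖x‖ ^ 2 ≤ 3 * S.toReal + 12⁻¹ * ‖x‖ ^ 2 := by
    have h1 := (hA.tendsto_primitive_atTop hT hdense x).add_const (6⁻¹ * ‖x‖ ^ 2)
    rw [zero_add] at h1
    refine le_of_tendsto h1 ?_
    filter_upwards [eventually_gt_atTop 0] with b hb using hzero b hb
  calc ENNReal.ofReal (‖x‖ ^ 2) ≤ ENNReal.ofReal (36 * S.toReal) :=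
        ENNReal.ofReal_le_ofReal (by linarith)
    _ = 36 * S := by
      rw [ENNReal.ofReal_mul (by norm_num), ENNReal.ofReal_toReal htop]
      norm_num

end SquareFunction

/-! ### Auxiliary integrals with values in `[0, ∞]`. -/

section Lintegral

/-- A weighted Cauchy–Schwarz inequality. -/
theorem sq_lintegral_mul_le {α : Type*} [MeasurableSpace α] {μ : Measure α} {w k h : α → ℝ≥0∞}
    (hw : Measurable w) (hk : Measurable k) (hh : Measurable h) (hk0 : ∀ᵐ a ∂μ, k a ≠ 0)
    (hktop : ∀ᵐ a ∂μ, k a ≠ ∞) :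
    (∫⁻ a, w a * h a ∂μ) ^ 2 ≤ (∫⁻ a, w a * (k a)⁻¹ ∂μ) * ∫⁻ a, w a * k a * h a ^ 2 ∂μ := by
  have h2 : ∀ y : ℝ≥0∞, (y ^ (1 / 2 : ℝ)) ^ (2 : ℝ) = y := fun y => by
    rw [← ENNReal.rpow_mul]; norm_num
  have hs : ∀ y : ℝ≥0∞, y ^ (1 / 2 : ℝ) * y ^ (1 / 2 : ℝ) = y := fun y => by
    rw [← ENNReal.rpow_add_of_nonneg _ _ (by norm_num) (by norm_num)]; norm_num
  have hol := ENNReal.lintegral_mul_le_Lp_mul_Lq μ Real.HolderConjugate.two_two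
    (f := fun a => (w a * (k a)⁻¹) ^ (1 / 2 : ℝ)) (g := fun a => (w a * k a) ^ (1 / 2 : ℝ) * h a)
    ((hw.mul hk.inv).pow_const _).aemeasurable
    (((hw.mul hk).pow_const _).mul hh).aemeasurable
  have e1 : ∫⁻ a, w a * h a ∂μ = ∫⁻ a, ((fun a => (w a * (k a)⁻¹) ^ (1 / 2 : ℝ)) *
      fun a => (w a * k a) ^ (1 / 2 : ℝ) * h a) a ∂μ := by
    refine lintegral_congr_ae ?_
    filter_upwards [hk0, hktop] with a h0 htop
    simp only [Pi.mul_apply]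
    rw [← mul_assoc, ← ENNReal.mul_rpow_of_nonneg _ _ (by norm_num : (0 : ℝ) ≤ 1 / 2)]
    have : w a * (k a)⁻¹ * (w a * k a) = w a * w a := by
      rw [mul_mul_mul_comm, ENNReal.inv_mul_cancel h0 htop, mul_one]
    rw [this, ENNReal.mul_rpow_of_nonneg _ _ (by norm_num : (0 : ℝ) ≤ 1 / 2), hs]
  have e2 : ∀ a, ((w a * k a) ^ (1 / 2 : ℝ) * h a) ^ (2 : ℝ) = w a * k a * h a ^ 2 := fun a => by
    rw [ENNReal.mul_rpow_of_nonneg _ _ (by norm_num : (0 : ℝ) ≤ 2), h2, ENNReal.rpow_two]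
  rw [← e1] at hol
  simp only [h2, e2] at hol
  refine (pow_le_pow_left₀ zero_le hol 2).trans_eq ?_
  rw [mul_pow, ← ENNReal.rpow_two, ← ENNReal.rpow_two, h2, h2]

theorem lintegral_comp_mul_left_Ioi {c : ℝ} (hc : 0 < c) (f : ℝ → ℝ≥0∞) :
    ∫⁻ u in Ioi (0 : ℝ), f (c * u) = ENNReal.ofReal c⁻¹ * ∫⁻ u in Ioi (0 : ℝ), f u := by
  have hemb : MeasurableEmbedding fun u : ℝ => c * u :=
    (Homeomorph.mulLeft₀ c hc.ne').measurableEmbedding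
  have hpre : (fun u : ℝ => c * u) ⁻¹' Ioi 0 = Ioi 0 := by
    ext u; simp [hc]
  have h1 : ∫⁻ u in Ioi (0 : ℝ), f u ∂(Measure.map (fun u : ℝ => c * u) volume) =
      ∫⁻ u in Ioi (0 : ℝ), f (c * u) := by
    rw [hemb.restrict_map, hemb.lintegral_map, hpre]
  rw [← h1, Real.map_volume_mul_left hc.ne', Measure.restrict_smul, lintegral_smul_measure,
    abs_of_pos (inv_pos.2 hc), smul_eq_mul]

theorem lintegral_exp_neg : ∫⁻ u in Ioi (0 : ℝ), ENNReal.ofReal (Real.exp (-u)) = 1 := by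
  rw [← ofReal_integral_eq_lintegral_ofReal (integrableOn_exp_neg_Ioi 0)
    (ae_of_all _ fun u => (Real.exp_pos _).le), integral_exp_neg_Ioi_zero, ENNReal.ofReal_one]

/-- `Γ(1/2)` as an integral with values in `[0, ∞]`. -/
def gammaHalf : ℝ≥0∞ :=
  ∫⁻ u in Ioi (0 : ℝ), ENNReal.ofReal (Real.exp (-u)) * (ENNReal.ofReal (u ^ (1 / 2 : ℝ)))⁻¹

theorem gammaHalf_ne_top : gammaHalf ≠ ∞ := by
  have h := (Real.GammaIntegral_convergent (s := 1 / 2) (by norm_num)).lintegral_lt_top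
  refine ne_of_eq_of_ne (setLIntegral_congr_fun measurableSet_Ioi fun u hu => ?_) h.ne
  have hu' : (0 : ℝ) < u := hu
  rw [← ENNReal.ofReal_inv_of_pos (by positivity), ← ENNReal.ofReal_mul (Real.exp_pos _).le,
    ← Real.rpow_neg hu'.le]
  norm_num

/-- `min(σ^{-1/2}, σ^{-3/2})`. -/
def weight (σ : ℝ) : ℝ≥0∞ :=
  if σ ≤ 1 then ENNReal.ofReal (σ ^ (-(1 / 2) : ℝ)) else ENNReal.ofReal (σ ^ (-(3 / 2) : ℝ))

theorem measurable_weight : Measurable weight := by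
  refine Measurable.ite measurableSet_Iic ?_ ?_ <;> fun_prop

theorem lintegral_weight_ne_top : ∫⁻ σ in Ioi (0 : ℝ), weight σ ≠ ∞ := by
  have h1 : IntegrableOn (fun σ : ℝ => σ ^ (-(1 / 2) : ℝ)) (Ioc 0 1) :=
    (intervalIntegrable_iff_integrableOn_Ioc_of_le zero_le_one).1
      (intervalIntegral.intervalIntegrable_rpow' (by norm_num))
  have h2 : IntegrableOn (fun σ : ℝ => σ ^ (-(3 / 2) : ℝ)) (Ioi 1) :=
    integrableOn_Ioi_rpow_of_lt (by norm_num) zero_lt_one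
  have e1 : ∫⁻ σ in Ioc (0 : ℝ) 1, weight σ =
      ∫⁻ σ in Ioc (0 : ℝ) 1, ENNReal.ofReal (σ ^ (-(1 / 2) : ℝ)) :=
    setLIntegral_congr_fun measurableSet_Ioc fun σ hσ => if_pos hσ.2
  have e2 : ∫⁻ σ in Ioi (1 : ℝ), weight σ =
      ∫⁻ σ in Ioi (1 : ℝ), ENNReal.ofReal (σ ^ (-(3 / 2) : ℝ)) :=
    setLIntegral_congr_fun measurableSet_Ioi fun σ hσ => if_neg (not_le.2 hσ)
  rw [← Ioc_union_Ioi_eq_Ioi (zero_le_one' ℝ)]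
  refine ne_top_of_le_ne_top ?_ (lintegral_union_le _ _ _)
  rw [e1, e2]
  exact (ENNReal.add_lt_top.2 ⟨h1.lintegral_lt_top, h2.lintegral_lt_top⟩).ne

theorem add_add_sq_le (a b c : ℝ≥0∞) : (a + b + c) ^ 2 ≤ 3 * (a ^ 2 + b ^ 2 + c ^ 2) := by
  rcases eq_or_ne a ∞ with rfl | ha
  · simp
  rcases eq_or_ne b ∞ with rfl | hb
  · simp
  rcases eq_or_ne c ∞ with rfl | hc
  · simp
  lift a to NNReal using ha
  lift b to NNReal using hb
  lift c to NNReal using hc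
  norm_cast
  have : ((a : ℝ) + b + c) ^ 2 ≤ 3 * ((a : ℝ) ^ 2 + (b : ℝ) ^ 2 + (c : ℝ) ^ 2) := by
    nlinarith [sq_nonneg ((a : ℝ) - b), sq_nonneg ((b : ℝ) - c), sq_nonneg ((a : ℝ) - c)]
  exact_mod_cast this

end Lintegral

/-! ### Output energy of products of resolvents. -/

section Energy

variable {X Y : Type*} [NormedAddCommGroup X] [InnerProductSpace ℂ X]
  [NormedAddCommGroup Y] [NormedSpace ℂ Y] {T : ℝ → X →L[ℂ] X} {A : X →ₗ.[ℂ] X}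

theorem IsContractionSemigroup.measurable_enorm_orbit (hT : IsContractionSemigroup T) (L : X →L[ℂ] Y)
    (t : ℝ) (x : X) :
    Measurable fun u : ℝ => ‖L (T (max (t * u) 0) x)‖ₑ :=
  (L.continuous.comp ((hT.continuous_orbit x).comp
    (by fun_prop : Continuous fun u : ℝ => t * u))).enorm.measurable

theorem IsContractionSemigroup.continuous_orbit_comp (hT : IsContractionSemigroup T) {α : Type*}
    [TopologicalSpace α] {f : α → ℝ} {g : α → X} (hf : Continuous f) (hg : Continuous g) :
    Continuous fun a => T (max (f a) 0) (g a) :=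
  hT.continuous_apply.comp (hf.prodMk hg)

variable (hT : IsContractionSemigroup T)

/-- A sum of three outputs of resolvents which dominates `C A^{-1/2} t A (1 + t A)⁻²` after
integration in `σ` against `weight`. -/
def IsContractionSemigroup.majorant (hT : IsContractionSemigroup T) (L : X →L[ℂ] Y) (x : X)
    (σ t : ℝ) : ℝ≥0∞ :=
  ‖L (hT.res (0 * t) (hT.res (1 * t) (hT.res t x)))‖ₑ +
    ‖L (hT.res (σ⁻¹ * t) (hT.res (1 * t) (hT.res t x)))‖ₑ +
    ‖L (hT.res (σ⁻¹ * t) (hT.res (0 * t) (hT.res t x)))‖ₑ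

theorem IsContractionSemigroup.measurable_majorant (L : X →L[ℂ] Y) (x : X) :
    Measurable fun p : ℝ × ℝ => hT.majorant L x p.2 p.1 := by
  have h : ∀ b : ℝ, Continuous fun p : ℝ × ℝ => ‖L (hT.res p.1 (hT.res (b * p.2)
      (hT.res p.2 x)))‖ₑ := fun b =>
    (L.continuous.comp (hT.continuous_res_comp (by fun_prop) (hT.continuous_res_comp (by fun_prop)
      (hT.continuous_res_comp (by fun_prop) continuous_const)))).enorm
  have h1 := (h 1).measurable.comp (by fun_prop : Measurable fun p : ℝ × ℝ => (0 * p.1, p.1))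
  have h2 := (h 1).measurable.comp (by fun_prop : Measurable fun p : ℝ × ℝ => (p.2⁻¹ * p.1, p.1))
  have h3 := (h 0).measurable.comp (by fun_prop : Measurable fun p : ℝ × ℝ => (p.2⁻¹ * p.1, p.1))
  exact (h1.add h2).add h3

variable [CompleteSpace X]

theorem IsContractionSemigroup.enorm_res_le [CompleteSpace Y] (L : X →L[ℂ] Y) (t : ℝ) (x : X) :
    ‖L (hT.res t x)‖ₑ ≤
      ∫⁻ u in Ioi (0 : ℝ), ENNReal.ofReal (Real.exp (-u)) * ‖L (T (max (t * u) 0) x)‖ₑ := by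
  rw [hT.res_apply, ← ContinuousLinearMap.integral_comp_comm _ (hT.integrable_exp_smul t x)]
  refine (enorm_integral_le_lintegral_enorm _).trans_eq (lintegral_congr fun u => ?_)
  rw [ContinuousLinearMap.map_smul_of_tower, enorm_smul, Real.enorm_eq_ofReal (Real.exp_pos _).le]

theorem IsContractionSemigroup.enorm_res_sq_le [CompleteSpace Y] (L : X →L[ℂ] Y) (t : ℝ) (x : X) :
    ‖L (hT.res t x)‖ₑ ^ 2 ≤
      ∫⁻ u in Ioi (0 : ℝ), ENNReal.ofReal (Real.exp (-u)) * ‖L (T (max (t * u) 0) x)‖ₑ ^ 2 := by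
  refine (pow_le_pow_left₀ zero_le (hT.enorm_res_le L t x) 2).trans ?_
  simpa [lintegral_exp_neg] using sq_lintegral_mul_le (μ := volume.restrict (Ioi (0 : ℝ)))
    (w := fun u => ENNReal.ofReal (Real.exp (-u))) (k := fun _ => 1) (by fun_prop)
    measurable_const (hT.measurable_enorm_orbit L t x) (by simp) (by simp)

theorem IsContractionSemigroup.enorm_res_sq_le_gammaHalf [CompleteSpace Y] (L : X →L[ℂ] Y) (t : ℝ)
    (x : X) :
    ‖L (hT.res t x)‖ₑ ^ 2 ≤ gammaHalf * ∫⁻ u in Ioi (0 : ℝ), ENNReal.ofReal (Real.exp (-u)) *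
      ENNReal.ofReal (u ^ (1 / 2 : ℝ)) * ‖L (T (max (t * u) 0) x)‖ₑ ^ 2 := by
  refine (pow_le_pow_left₀ zero_le (hT.enorm_res_le L t x) 2).trans ?_
  refine sq_lintegral_mul_le (μ := volume.restrict (Ioi (0 : ℝ)))
    (w := fun u => ENNReal.ofReal (Real.exp (-u))) (by fun_prop) (by fun_prop)
    (hT.measurable_enorm_orbit L t x) ?_ (by simp)
  filter_upwards [ae_restrict_mem measurableSet_Ioi] with u hu
  have hu' : (0 : ℝ) < u := hu
  exact (ENNReal.ofReal_pos.2 (by positivity)).ne'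

/-- Here `T(ct) J_t x` averages `T((c+u)t) x` against `e^{-u} du`, and rescaling `t` costs
`(c+u)⁻¹`, which at `c = 0` is not integrable near `u = 0`. Cauchy–Schwarz with weight `u^{1/2}`
leaves only `u^{-1/2}`, uniformly in `c`. -/
theorem IsContractionSemigroup.lintegral_orbit_res_sq_le [CompleteSpace Y] (L : X →L[ℂ] Y)
    {c : ℝ} (hc : 0 ≤ c) (x : X) :
    ∫⁻ t in Ioi (0 : ℝ), ‖L (T (max (c * t) 0) (hT.res t x))‖ₑ ^ 2 ≤
      gammaHalf ^ 2 * ∫⁻ t in Ioi (0 : ℝ), ‖L (T (max t 0) x)‖ₑ ^ 2 := by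
  set E := ∫⁻ t in Ioi (0 : ℝ), ‖L (T (max t 0) x)‖ₑ ^ 2
  set K : ℝ → ℝ → ℝ≥0∞ := fun t u => ENNReal.ofReal (Real.exp (-u)) *
      ENNReal.ofReal (u ^ (1 / 2 : ℝ)) * ‖L (T (max ((c + u) * t) 0) x)‖ₑ ^ 2 with hK
  have hG : Measurable fun p : ℝ × ℝ => ‖L (T (max ((c + p.2) * p.1) 0) x)‖ₑ ^ 2 :=
    ((L.continuous.comp (hT.continuous_orbit_comp (by fun_prop) continuous_const)).enorm.measurable
      ).pow_const 2
  have hKm : Measurable (Function.uncurry K) :=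
    Measurable.mul (f := fun p : ℝ × ℝ => ENNReal.ofReal (Real.exp (-p.2)) *
      ENNReal.ofReal (p.2 ^ (1 / 2 : ℝ))) (by fun_prop) hG
  have h1 : ∀ t ∈ Ioi (0 : ℝ), ‖L (T (max (c * t) 0) (hT.res t x))‖ₑ ^ 2 ≤
      gammaHalf * ∫⁻ u in Ioi (0 : ℝ), K t u := by
    intro t ht
    have ht' : (0 : ℝ) < t := ht
    refine (hT.enorm_res_sq_le_gammaHalf (L.comp (T (max (c * t) 0))) t x).trans_eq ?_
    congr 1
    refine setLIntegral_congr_fun measurableSet_Ioi fun u hu => ?_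
    have hu' : (0 : ℝ) < u := hu
    simp only [hK, ContinuousLinearMap.comp_apply]
    rw [← hT.add_apply (le_max_right _ _) (le_max_right _ _), max_eq_left (by positivity),
      max_eq_left (by positivity), max_eq_left (by positivity)]
    congr 6
    ring
  calc _ ≤ ∫⁻ t in Ioi (0 : ℝ), gammaHalf * ∫⁻ u in Ioi (0 : ℝ), K t u :=
        setLIntegral_mono' measurableSet_Ioi h1
    _ = gammaHalf * ∫⁻ u in Ioi (0 : ℝ), ∫⁻ t in Ioi (0 : ℝ), K t u := by
      have hKm' : Measurable fun t => ∫⁻ u in Ioi (0 : ℝ), K t u := hKm.lintegral_prod_right'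
      rw [lintegral_const_mul _ hKm', lintegral_lintegral_swap hKm.aemeasurable]
    _ ≤ gammaHalf * ∫⁻ u in Ioi (0 : ℝ), ENNReal.ofReal (Real.exp (-u)) *
        (ENNReal.ofReal (u ^ (1 / 2 : ℝ)))⁻¹ * E := by
      refine mul_le_mul' le_rfl ?_
      refine setLIntegral_mono' measurableSet_Ioi fun u hu => ?_
      have hu' : (0 : ℝ) < u := hu
      have hcu : 0 < c + u := by positivity
      have e := lintegral_comp_mul_left_Ioi hcu fun t => ‖L (T (max t 0) x)‖ₑ ^ 2
      rw [lintegral_const_mul' _ _ (by finiteness), e, ← mul_assoc]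
      gcongr ?_ * _
      rw [mul_assoc, ← ENNReal.ofReal_inv_of_pos (by positivity),
        ← ENNReal.ofReal_mul (by positivity)]
      gcongr
      calc u ^ (1 / 2 : ℝ) * (c + u)⁻¹ ≤ u ^ (1 / 2 : ℝ) * u⁻¹ := by
            gcongr
            linarith
        _ = (u ^ (1 / 2 : ℝ))⁻¹ := by
            rw [← Real.rpow_neg hu'.le, ← Real.rpow_neg_one, ← Real.rpow_add hu']
            norm_num
    _ = gammaHalf ^ 2 * E := by
      rw [lintegral_mul_const _ (by fun_prop), ← gammaHalf, sq, mul_assoc]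

/-- A further resolvent `J_{bt}` only averages the bound over the delays `c + b u`, so a bound
uniform in the delay survives unchanged and the lemma can be iterated. -/
theorem IsContractionSemigroup.lintegral_orbit_res_comp_sq_le [CompleteSpace Y] (L : X →L[ℂ] Y)
    {V : ℝ → X} (hV : Continuous V) {M : ℝ≥0∞}
    (hM : ∀ c, 0 ≤ c → ∫⁻ t in Ioi (0 : ℝ), ‖L (T (max (c * t) 0) (V t))‖ₑ ^ 2 ≤ M)
    {b c : ℝ} (hb : 0 ≤ b) (hc : 0 ≤ c) :
    ∫⁻ t in Ioi (0 : ℝ), ‖L (T (max (c * t) 0) (hT.res (b * t) (V t)))‖ₑ ^ 2 ≤ M := by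
  set K : ℝ → ℝ → ℝ≥0∞ := fun t u => ENNReal.ofReal (Real.exp (-u)) *
      ‖L (T (max ((c + b * u) * t) 0) (V t))‖ₑ ^ 2 with hK
  have hG : Measurable fun p : ℝ × ℝ => ‖L (T (max ((c + b * p.2) * p.1) 0) (V p.1))‖ₑ ^ 2 :=
    ((L.continuous.comp (hT.continuous_orbit_comp (by fun_prop) (by fun_prop))).enorm.measurable
      ).pow_const 2
  have hKm : Measurable (Function.uncurry K) :=
    Measurable.mul (f := fun p : ℝ × ℝ => ENNReal.ofReal (Real.exp (-p.2))) (by fun_prop) hG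
  calc _ ≤ ∫⁻ t in Ioi (0 : ℝ), ∫⁻ u in Ioi (0 : ℝ), K t u := by
        refine setLIntegral_mono' measurableSet_Ioi fun t ht => ?_
        have ht' : (0 : ℝ) < t := ht
        refine (hT.enorm_res_sq_le (L.comp (T (max (c * t) 0))) (b * t) (V t)).trans_eq ?_
        refine setLIntegral_congr_fun measurableSet_Ioi fun u hu => ?_
        have hu' : (0 : ℝ) < u := hu
        simp only [hK, ContinuousLinearMap.comp_apply]
        rw [← hT.add_apply (le_max_right _ _) (le_max_right _ _), max_eq_left (by positivity),
          max_eq_left (by positivity), max_eq_left (by positivity)]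
        congr 6
        ring
    _ = ∫⁻ u in Ioi (0 : ℝ), ∫⁻ t in Ioi (0 : ℝ), K t u :=
      lintegral_lintegral_swap hKm.aemeasurable
    _ ≤ ∫⁻ u in Ioi (0 : ℝ), ENNReal.ofReal (Real.exp (-u)) * M := by
      refine setLIntegral_mono' measurableSet_Ioi fun u hu => ?_
      have hu' : (0 : ℝ) < u := hu
      simp only [hK]
      rw [lintegral_const_mul' _ _ (by finiteness)]
      gcongr
      exact hM _ (by positivity)
    _ = M := by rw [lintegral_mul_const _ (by fun_prop), lintegral_exp_neg, one_mul]

/-- The values `a = 0` and `b = 0` cover shorter products as well, because `J_0 = 1`. -/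
theorem IsContractionSemigroup.lintegral_res_res_res_sq_le [CompleteSpace Y] (L : X →L[ℂ] Y)
    {a b : ℝ} (ha : 0 ≤ a) (hb : 0 ≤ b) (x : X) :
    ∫⁻ t in Ioi (0 : ℝ), ‖L (hT.res (a * t) (hT.res (b * t) (hT.res t x)))‖ₑ ^ 2 ≤
      gammaHalf ^ 2 * ∫⁻ t in Ioi (0 : ℝ), ‖L (T (max t 0) x)‖ₑ ^ 2 := by
  have hV : Continuous fun t => hT.res t x := hT.continuous_res_comp continuous_id continuous_const
  have h1 := hT.lintegral_orbit_res_comp_sq_le L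
    (hT.continuous_res_comp (f := fun t => b * t) (by fun_prop) hV)
    (fun c hc => hT.lintegral_orbit_res_comp_sq_le L hV
      (fun c hc => hT.lintegral_orbit_res_sq_le L hc x) hb hc) ha le_rfl
  simpa [hT.map_zero] using h1

theorem IsContractionSemigroup.lintegral_majorant_sq_le [CompleteSpace Y] (L : X →L[ℂ] Y) {σ : ℝ}
    (hσ : 0 < σ) (x : X) :
    ∫⁻ t in Ioi (0 : ℝ), hT.majorant L x σ t ^ 2 ≤
      9 * gammaHalf ^ 2 * ∫⁻ t in Ioi (0 : ℝ), ‖L (T (max t 0) x)‖ₑ ^ 2 := by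
  have hm : ∀ a b : ℝ, Measurable fun t : ℝ =>
      ‖L (hT.res (a * t) (hT.res (b * t) (hT.res t x)))‖ₑ ^ 2 := fun a b =>
    ((L.continuous.comp (hT.continuous_res_comp (by fun_prop) (hT.continuous_res_comp (by fun_prop)
      (hT.continuous_res_comp continuous_id continuous_const)))).enorm.measurable).pow_const 2
  have h1 := hT.lintegral_res_res_res_sq_le L le_rfl zero_le_one x
  have h2 := hT.lintegral_res_res_res_sq_le L (inv_pos.2 hσ).le zero_le_one x
  have h3 := hT.lintegral_res_res_res_sq_le L (inv_pos.2 hσ).le le_rfl x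
  refine (lintegral_mono fun t => add_add_sq_le _ _ _).trans ?_
  rw [lintegral_const_mul' _ _ (by finiteness), lintegral_add_right _ (hm _ _),
    lintegral_add_right _ (hm _ _)]
  refine (mul_le_mul' le_rfl (add_le_add (add_le_add h1 h2) h3)).trans_eq ?_
  ring

/-- Cauchy–Schwarz in `σ` against the finite measure `weight σ dσ`, then Tonelli and the bound
uniform in `σ`. -/
theorem IsContractionSemigroup.lintegral_sq_weight_majorant_le [CompleteSpace Y] (L : X →L[ℂ] Y)
    (x : X) :
    ∫⁻ t in Ioi (0 : ℝ), (∫⁻ σ in Ioi (0 : ℝ), weight σ * hT.majorant L x σ t) ^ 2 ≤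
      9 * gammaHalf ^ 2 * (∫⁻ σ in Ioi (0 : ℝ), weight σ) ^ 2 *
        ∫⁻ t in Ioi (0 : ℝ), ‖L (T (max t 0) x)‖ₑ ^ 2 := by
  have hm := hT.measurable_majorant L x
  have hKm : Measurable (Function.uncurry fun t σ => weight σ * hT.majorant L x σ t ^ 2) :=
    (measurable_weight.comp measurable_snd).mul (hm.pow_const 2)
  set M := ∫⁻ σ in Ioi (0 : ℝ), weight σ
  set E := ∫⁻ t in Ioi (0 : ℝ), ‖L (T (max t 0) x)‖ₑ ^ 2
  calc _ ≤ ∫⁻ t in Ioi (0 : ℝ), M * ∫⁻ σ in Ioi (0 : ℝ), weight σ * hT.majorant L x σ t ^ 2 := by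
        refine lintegral_mono fun t => ?_
        simpa using sq_lintegral_mul_le (μ := volume.restrict (Ioi (0 : ℝ))) measurable_weight
          (k := fun _ => 1) measurable_const (hm.comp (measurable_prodMk_left (x := t)))
          (by simp) (by simp)
    _ = M * ∫⁻ σ in Ioi (0 : ℝ), ∫⁻ t in Ioi (0 : ℝ), weight σ * hT.majorant L x σ t ^ 2 := by
      have hKm' : Measurable fun t => ∫⁻ σ in Ioi (0 : ℝ), weight σ * hT.majorant L x σ t ^ 2 :=
        hKm.lintegral_prod_right'
      rw [lintegral_const_mul _ hKm', lintegral_lintegral_swap hKm.aemeasurable]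
    _ ≤ M * ∫⁻ σ in Ioi (0 : ℝ), weight σ * (9 * gammaHalf ^ 2 * E) := by
      refine mul_le_mul' le_rfl ?_
      refine setLIntegral_mono' measurableSet_Ioi fun σ hσ => ?_
      have hm' : Measurable fun t => hT.majorant L x σ t ^ 2 :=
        (hm.comp (measurable_prodMk_right (y := σ))).pow_const 2
      rw [lintegral_const_mul _ hm']
      gcongr
      exact hT.lintegral_majorant_sq_le L hσ x
    _ = _ := by
      rw [lintegral_mul_const _ measurable_weight]
      ring

end Energy

/-! ### Balakrishnan's formula and the observability estimate. -/

section Observation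

variable {X Y : Type*} [NormedAddCommGroup X] [InnerProductSpace ℂ X]
  [NormedAddCommGroup Y] [NormedSpace ℂ Y] {T : ℝ → X →L[ℂ] X} {A : X →ₗ.[ℂ] X}
  (hT : IsContractionSemigroup T)

/-- The integrand `s^{-1/2} (s + A)⁻¹ t A (1 + t A)⁻² x` of Balakrishnan's formula. -/
def IsContractionSemigroup.balakrishnan (hT : IsContractionSemigroup T) (t : ℝ) (x : X) (s : ℝ) :
    X :=
  s ^ (-(1 / 2) : ℝ) • (s⁻¹ • hT.res s⁻¹ (hT.band t x))

theorem IsContractionSemigroup.continuousOn_balakrishnan (t : ℝ) (x : X) :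
    ContinuousOn (hT.balakrishnan t x) (Ioi 0) := by
  have hne : ∀ s ∈ Ioi (0 : ℝ), s ≠ 0 := fun s hs => (ne_of_gt hs)
  have h1 : ContinuousOn (fun s : ℝ => s⁻¹) (Ioi 0) := continuousOn_inv₀.mono hne
  have h2 : Continuous fun r => hT.res r (hT.band t x) :=
    hT.continuous_res_comp continuous_id continuous_const
  exact (continuousOn_id.rpow_const fun s hs => Or.inl (hne s hs)).smul
    (h1.smul (h2.comp_continuousOn h1))

variable [CompleteSpace X]

/-- The factor `σ^{-3/2}` is integrable at infinity but not at `0`. For `σ ≤ 1` the resolvent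
identity gives `σ⁻¹ J_{t/σ} E_t = J_t² - J_{t/σ} J_t²`, which gains one power of `σ`; for `σ > 1`
expanding `E_t = J_t - J_t²` suffices. -/
theorem IsGenerator.enorm_res_band_le (hA : IsGenerator T (-A)) (L : X →L[ℂ] Y) {σ t : ℝ}
    (hσ : 0 < σ) (ht : 0 < t) (x : X) :
    ENNReal.ofReal (σ ^ (-(3 / 2) : ℝ)) * ‖L (hT.res (σ⁻¹ * t) (hT.band t x))‖ₑ ≤
      weight σ * hT.majorant L x σ t := by
  have hmaj : hT.majorant L x σ t = ‖L (hT.res t (hT.res t x))‖ₑ +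
      ‖L (hT.res (σ⁻¹ * t) (hT.res t (hT.res t x)))‖ₑ +
      ‖L (hT.res (σ⁻¹ * t) (hT.res t x))‖ₑ := by
    simp only [IsContractionSemigroup.majorant, zero_mul, one_mul, hT.res_zero]
  rw [hmaj]
  by_cases h : σ ≤ 1
  · rw [weight, if_pos h]
    have hid := hA.smul_res_sub hT (mul_pos (inv_pos.2 hσ) ht) ht (hT.res t x)
    rw [← map_sub, ← hT.band_apply, mul_comm, mul_smul] at hid
    have hid' : σ⁻¹ • hT.res (t * σ⁻¹) (hT.band t x) =
        hT.res t (hT.res t x) - hT.res (t * σ⁻¹) (hT.res t (hT.res t x)) :=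
      smul_right_injective X ht.ne' hid
    have e : ENNReal.ofReal (σ ^ (-(3 / 2) : ℝ)) * ‖L (hT.res (σ⁻¹ * t) (hT.band t x))‖ₑ =
        ENNReal.ofReal (σ ^ (-(1 / 2) : ℝ)) *
          ‖L (hT.res t (hT.res t x)) - L (hT.res (σ⁻¹ * t) (hT.res t (hT.res t x)))‖ₑ := by
      rw [← map_sub, mul_comm σ⁻¹, ← hid', ContinuousLinearMap.map_smul_of_tower, enorm_smul,
        Real.enorm_eq_ofReal (inv_pos.2 hσ).le, ← mul_assoc,
        ← ENNReal.ofReal_mul (by positivity), ← Real.rpow_neg_one σ, ← Real.rpow_add hσ]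
      norm_num
    rw [e]
    refine mul_le_mul' le_rfl (enorm_sub_le.trans ?_)
    exact le_self_add
  · rw [weight, if_neg h]
    refine mul_le_mul' le_rfl ?_
    rw [hT.band_apply, map_sub, map_sub]
    refine enorm_sub_le.trans ?_
    rw [add_assoc, add_comm (‖L (hT.res (σ⁻¹ * t) (hT.res t (hT.res t x)))‖ₑ)]
    exact le_add_self

/-- The substitution `s = σ/t` extracts the factor `t^{1/2}`. -/
theorem IsGenerator.lintegral_balakrishnan_le (hA : IsGenerator T (-A)) (L : X →L[ℂ] Y) {t : ℝ}
    (ht : 0 < t) (x : X) :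
    ∫⁻ s in Ioi (0 : ℝ), ‖L (hT.balakrishnan t x s)‖ₑ ≤ ENNReal.ofReal (t ^ (1 / 2 : ℝ)) *
      ∫⁻ σ in Ioi (0 : ℝ), weight σ * hT.majorant L x σ t := by
  have hsc := lintegral_comp_mul_left_Ioi (inv_pos.2 ht)
    fun s => ‖L (hT.balakrishnan t x s)‖ₑ
  rw [inv_inv] at hsc
  have e : ∫⁻ s in Ioi (0 : ℝ), ‖L (hT.balakrishnan t x s)‖ₑ =
      ENNReal.ofReal t⁻¹ * ∫⁻ σ in Ioi (0 : ℝ), ‖L (hT.balakrishnan t x (t⁻¹ * σ))‖ₑ := by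
    rw [hsc, ← mul_assoc, ← ENNReal.ofReal_mul (inv_pos.2 ht).le, inv_mul_cancel₀ ht.ne',
      ENNReal.ofReal_one, one_mul]
  rw [e, ← lintegral_const_mul' _ _ ENNReal.ofReal_ne_top,
    ← lintegral_const_mul' _ _ ENNReal.ofReal_ne_top]
  refine setLIntegral_mono' measurableSet_Ioi fun σ hσ => ?_
  have hσ' : (0 : ℝ) < σ := hσ
  refine le_trans (le_of_eq ?_) (mul_le_mul' le_rfl (hA.enorm_res_band_le hT L hσ' ht x))
  have hinv : (t⁻¹ * σ)⁻¹ = σ⁻¹ * t := by rw [mul_inv, inv_inv, mul_comm]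
  rw [IsContractionSemigroup.balakrishnan, ContinuousLinearMap.map_smul_of_tower,
    ContinuousLinearMap.map_smul_of_tower, enorm_smul, enorm_smul, hinv,
    Real.enorm_eq_ofReal (by positivity), Real.enorm_eq_ofReal (by positivity), ← mul_assoc,
    ← mul_assoc, ← mul_assoc, ← ENNReal.ofReal_mul (by positivity),
    ← ENNReal.ofReal_mul (by positivity), ← ENNReal.ofReal_mul (by positivity)]
  congr 2
  rw [Real.mul_rpow (by positivity) hσ'.le, Real.inv_rpow ht.le, ← Real.rpow_neg ht.le, neg_neg]
  have : σ ^ (-(3 / 2) : ℝ) = σ ^ (-(1 / 2) : ℝ) * σ⁻¹ := by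
    rw [← Real.rpow_neg_one σ, ← Real.rpow_add hσ']
    norm_num
  rw [this]
  field_simp

/-- The preceding bound with the identity as observation; contractivity of the resolvents bounds the
majorant by `3‖x‖`. -/
theorem IsGenerator.integrableOn_balakrishnan (hA : IsGenerator T (-A)) {t : ℝ} (ht : 0 < t)
    (x : X) : IntegrableOn (hT.balakrishnan t x) (Ioi 0) := by
  refine ⟨(hT.continuousOn_balakrishnan t x).aestronglyMeasurable measurableSet_Ioi, ?_⟩
  have h := hA.lintegral_balakrishnan_le hT (ContinuousLinearMap.id ℂ X) ht x
  refine lt_of_le_of_lt h (ENNReal.mul_lt_top ENNReal.ofReal_lt_top ?_)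
  have hle : ∀ s (y : X), ‖hT.res s y‖ₑ ≤ ‖y‖ₑ := fun s y =>
    enorm_le_iff_norm_le.2 (hT.norm_res_apply_le s y)
  have hmaj : ∀ σ, hT.majorant (ContinuousLinearMap.id ℂ X) x σ t ≤ ‖x‖ₑ + ‖x‖ₑ + ‖x‖ₑ := by
    intro σ
    refine add_le_add (add_le_add ?_ ?_) ?_ <;>
      exact (hle _ _).trans ((hle _ _).trans (hle _ _))
  refine lt_of_le_of_lt (lintegral_mono fun σ => mul_le_mul' le_rfl (hmaj σ)) ?_
  rw [lintegral_mul_const _ measurable_weight]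
  exact ENNReal.mul_lt_top lintegral_weight_ne_top.lt_top (by finiteness)

theorem IsContractionSemigroup.band_res (s t : ℝ) (x : X) :
    hT.band t (hT.res s x) = hT.res s (hT.band t x) := by
  rw [hT.band_apply, hT.band_apply, map_sub, hT.res_comm t s, hT.res_comm t s]

theorem IsGenerator.band_mem_range (hA : IsGenerator T (-A)) {t : ℝ} (ht : 0 < t) (x : X) :
    hT.band t x ∈ opRange A := by
  have h := hA.res_mem_graph hT ht (hT.res t x)
  obtain ⟨y, -, hy⟩ := (LinearPMap.mem_graph_iff _).1 h
  have h2 : hT.band t x = ((t : ℝ) : ℂ) • A y := by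
    rw [hy, Complex.coe_smul]
    simp only [smul_smul, mul_inv_cancel₀ ht.ne', one_smul]
    rfl
  rw [h2]
  exact (opRange A).smul_mem _ ⟨y, rfl⟩

/-- Pulling `J_1` out of the integral puts the result in `D(A)` and lets `C` act through the bounded
operator `C J_1`. -/
theorem IsGenerator.negSqrt_band (hA : IsGenerator T (-A)) {t : ℝ} (ht : 0 < t) (x : X) :
    negSqrt A (hT.band t (hT.res 1 x)) =
      hT.res 1 (Real.pi⁻¹ • ∫ s in Ioi (0 : ℝ), hT.balakrishnan t x s) := by
  rw [negSqrt, ContinuousLinearMap.map_smul_of_tower,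
    ← ContinuousLinearMap.integral_comp_comm _ (hA.integrableOn_balakrishnan hT ht x)]
  congr 1
  refine setIntegral_congr_fun measurableSet_Ioi fun s hs => ?_
  rw [hA.resolventAt_eq hT hs, hT.band_res, hT.res_comm s⁻¹ 1, IsContractionSemigroup.balakrishnan,
    ContinuousLinearMap.map_smul_of_tower, ContinuousLinearMap.map_smul_of_tower]

/-- A graph-bounded observation operator composed with `(1 + A)⁻¹` is bounded. -/
theorem IsGenerator.exists_clm (hA : IsGenerator T (-A)) {C : A.domain →ₗ[ℂ] Y}
    (hC : IsGraphBounded A C) :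
    ∃ L : X →L[ℂ] Y, ∀ y, L y = C ⟨hT.res 1 y, hA.res_mem_domain hT one_pos y⟩ := by
  obtain ⟨K, hK⟩ := hC
  -- The `3` comes from `‖J_1 y‖ + ‖y - J_1 y‖ ≤ 3‖y‖`; the absolute value allows for a negative
  -- `K`.
  refine ⟨LinearMap.mkContinuous
    (C.comp ((hT.res 1).toLinearMap.codRestrict A.domain fun y => hA.res_mem_domain hT one_pos y))
    (|K| * 3) fun y => ?_, fun y => rfl⟩
  obtain ⟨z, hz, hAz⟩ := (LinearPMap.mem_graph_iff _).1 (hA.res_mem_graph hT one_pos y)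
  have hz' : (hT.res 1).toLinearMap.codRestrict A.domain
      (fun y => hA.res_mem_domain hT one_pos y) y = z := Subtype.ext hz.symm
  rw [LinearMap.comp_apply, hz']
  refine (hK z).trans ?_
  rw [hz, hAz, inv_one, one_smul, mul_assoc]
  have h1 := hT.norm_res_apply_le 1 y
  have h2 := norm_sub_le y (hT.res 1 y)
  gcongr
  · exact le_abs_self K
  · simp only
    linarith

theorem IsGenerator.exists_eq_res_one (hA : IsGenerator T (-A)) {x : X} (hx : x ∈ A.domain) :
    ∃ y, x = hT.res 1 y :=
  ⟨x + (1 : ℝ) • A ⟨x, hx⟩, hA.eq_res hT one_pos (A.mem_graph ⟨x, hx⟩) rfl⟩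

theorem outputEnergy_res (hA : IsGenerator T (-A)) {C : A.domain →ₗ[ℂ] Y} {L : X →L[ℂ] Y}
    (hL : ∀ y, L y = C ⟨hT.res 1 y, hA.res_mem_domain hT one_pos y⟩) (y : X) :
    outputEnergy A C T (hT.res 1 y) = ∫⁻ t in Ioi (0 : ℝ), ‖L (T (max t 0) y)‖ₑ ^ 2 := by
  refine setLIntegral_congr_fun measurableSet_Ioi fun t ht => ?_
  have ht' : (0 : ℝ) ≤ t := le_of_lt ht
  have hmem := hA.apply_mem_domain hT (hA.res_mem_domain hT one_pos y) ht'
  simp only [output, dif_pos hmem, hL, max_eq_left ht', hT.apply_res ht']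

theorem IsGenerator.exists_le_outputEnergy [CompleteSpace Y] (hT : IsContractionSemigroup T)
    (hA : IsGenerator T (-A)) (hdense : Dense (opRange A : Set X)) {C : A.domain →ₗ[ℂ] Y}
    (hC : IsGraphBounded A C) {δ : ℝ} (hδ : 0 < δ)
    (hlower : ∀ x : X, x ∈ A.domain → x ∈ opRange A → ∀ h : negSqrt A x ∈ A.domain,
      δ * ‖x‖ ≤ ‖C ⟨negSqrt A x, h⟩‖) :
    ∃ κ : ℝ≥0∞, κ ≠ ∞ ∧ ∀ x ∈ A.domain,
      ENNReal.ofReal (‖x‖ ^ 2) ≤ κ * outputEnergy A C T x := by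
  obtain ⟨L, hL⟩ := hA.exists_clm hT hC
  set M := ∫⁻ σ in Ioi (0 : ℝ), weight σ
  have hMtop : M ≠ ∞ := lintegral_weight_ne_top
  have hgtop := gammaHalf_ne_top
  -- The factors come from the square function estimate, the lower bound on `C A^{-1/2}`, and the
  -- energy bound for the majorant.
  refine ⟨36 * (ENNReal.ofReal (δ⁻¹ ^ 2) * (9 * gammaHalf ^ 2 * M ^ 2)), by finiteness,
    fun x hx => ?_⟩
  obtain ⟨y, rfl⟩ := hA.exists_eq_res_one hT hx
  rw [outputEnergy_res hT hA hL, mul_assoc, mul_assoc]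
  refine (hA.norm_sq_le_lintegral_band hT hdense _).trans (mul_le_mul' le_rfl ?_)
  refine le_trans ?_ (mul_le_mul' le_rfl (hT.lintegral_sq_weight_majorant_le L y))
  rw [← lintegral_const_mul' _ _ ENNReal.ofReal_ne_top]
  refine setLIntegral_mono' measurableSet_Ioi fun t ht => ?_
  have ht' : (0 : ℝ) < t := ht
  set I := ∫⁻ σ in Ioi (0 : ℝ), weight σ * hT.majorant L y σ t
  have hmem : negSqrt A (hT.band t (hT.res 1 y)) ∈ A.domain := by
    rw [hA.negSqrt_band hT ht']
    exact hA.res_mem_domain hT one_pos _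
  have hdom : hT.band t (hT.res 1 y) ∈ A.domain := by
    rw [hT.band_res]
    exact hA.res_mem_domain hT one_pos _
  have h1 := hlower _ hdom (hA.band_mem_range hT ht' _) hmem
  have h2 : C ⟨negSqrt A (hT.band t (hT.res 1 y)), hmem⟩ =
      Real.pi⁻¹ • ∫ s in Ioi (0 : ℝ), L (hT.balakrishnan t y s) := by
    rw [ContinuousLinearMap.integral_comp_comm _ (hA.integrableOn_balakrishnan hT ht' y),
      ← ContinuousLinearMap.map_smul_of_tower, hL]
    exact congrArg C (Subtype.ext (hA.negSqrt_band hT ht' y))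
  have hpi : Real.pi⁻¹ ≤ 1 := inv_le_one_of_one_le₀ (by linarith [Real.pi_gt_three])
  have h3 : ‖hT.band t (hT.res 1 y)‖ ≤ δ⁻¹ * ‖∫ s in Ioi (0 : ℝ), L (hT.balakrishnan t y s)‖ := by
    rw [h2, norm_smul, Real.norm_eq_abs, abs_of_pos (inv_pos.2 Real.pi_pos)] at h1
    rw [inv_mul_eq_div, le_div_iff₀' hδ]
    refine h1.trans (mul_le_of_le_one_left (norm_nonneg _) hpi)
  have h4 : ‖∫ s in Ioi (0 : ℝ), L (hT.balakrishnan t y s)‖ₑ ≤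
      ENNReal.ofReal (t ^ (1 / 2 : ℝ)) * I :=
    (enorm_integral_le_lintegral_enorm _).trans (hA.lintegral_balakrishnan_le hT L ht' y)
  have h5 : (t ^ (1 / 2 : ℝ)) ^ 2 = t := by
    rw [← Real.rpow_natCast, ← Real.rpow_mul ht'.le]
    norm_num
  calc ENNReal.ofReal (t⁻¹ * ‖hT.band t (hT.res 1 y)‖ ^ 2)
      ≤ ENNReal.ofReal (t⁻¹ * (δ⁻¹ * ‖∫ s in Ioi (0 : ℝ), L (hT.balakrishnan t y s)‖) ^ 2) := by
        gcongr
    _ = ENNReal.ofReal t⁻¹ * ENNReal.ofReal (δ⁻¹ ^ 2) *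
        ‖∫ s in Ioi (0 : ℝ), L (hT.balakrishnan t y s)‖ₑ ^ 2 := by
      rw [mul_pow, ← mul_assoc, ENNReal.ofReal_mul (by positivity),
        ENNReal.ofReal_mul (by positivity), ENNReal.ofReal_pow (norm_nonneg _), ofReal_norm]
    _ ≤ ENNReal.ofReal t⁻¹ * ENNReal.ofReal (δ⁻¹ ^ 2) *
        (ENNReal.ofReal (t ^ (1 / 2 : ℝ)) * I) ^ 2 := by gcongr
    -- The square of `t^{1/2}` cancels the `t⁻¹` of the measure `dt/t`, leaving the plain `dt` of
    -- the output energy.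
    _ = ENNReal.ofReal (t⁻¹ * t) * (ENNReal.ofReal (δ⁻¹ ^ 2) * I ^ 2) := by
      rw [mul_pow, ← ENNReal.ofReal_pow (by positivity), h5, ENNReal.ofReal_mul (by positivity)]
      ring
    _ = ENNReal.ofReal (δ⁻¹ ^ 2) * I ^ 2 := by
      rw [inv_mul_cancel₀ ht'.ne', ENNReal.ofReal_one, one_mul]

end Observation

end Observability

end

/-! ### Conclusion. -/

theorem mainTheorem3 {X Y : Type*} [NormedAddCommGroup X] [InnerProductSpace ℂ X]
    [CompleteSpace X] [NormedAddCommGroup Y] [NormedSpace ℂ Y] [CompleteSpace Y]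
    (T : ℝ → X →L[ℂ] X) (hT : Observability.IsContractionSemigroup T)
    (A : X →ₗ.[ℂ] X) (hA : Observability.IsGenerator T (-A))
    (hdense : Dense (Observability.opRange A : Set X))
    (C : A.domain →ₗ[ℂ] Y) (hC : Observability.IsGraphBounded A C)
    (δ : ℝ) (hδ : 0 < δ)
    (hlower : ∀ x : X, x ∈ A.domain → x ∈ Observability.opRange A →
      ∀ h : Observability.negSqrt A x ∈ A.domain,
        δ * ‖x‖ ≤ ‖C ⟨Observability.negSqrt A x, h⟩‖) :
    (∃ m : ℝ, 0 < m ∧ ∀ x : X, x ∈ A.domain → x ∈ Observability.opRange A →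
      ENNReal.ofReal (m ^ 2 * ‖x‖ ^ 2) ≤ Observability.outputEnergy A C T x) ∧
    (Observability.IsBoundedlyInvertible A ∨ Observability.IsInfiniteTimeAdmissible A C T →
      Observability.IsInfiniteTimeExactlyObservable A C T) := by
  obtain ⟨κ, hκ, h⟩ := hA.exists_le_outputEnergy hT hdense hC hδ hlower
  have hκ0 : 0 ≤ κ.toReal := ENNReal.toReal_nonneg
  -- Using `κ + 1` avoids a case distinction at `κ = 0`.
  have hpos : 0 < (κ.toReal + 1)⁻¹ := by positivity
  have key : ∀ x ∈ A.domain, ENNReal.ofReal ((κ.toReal + 1)⁻¹ * ‖x‖ ^ 2) ≤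
      Observability.outputEnergy A C T x := fun x hx =>
    calc ENNReal.ofReal ((κ.toReal + 1)⁻¹ * ‖x‖ ^ 2)
        ≤ ENNReal.ofReal (κ.toReal + 1)⁻¹ * (κ * Observability.outputEnergy A C T x) := by
          rw [ENNReal.ofReal_mul hpos.le]
          exact mul_le_mul' le_rfl (h x hx)
      _ = ENNReal.ofReal ((κ.toReal + 1)⁻¹ * κ.toReal) * Observability.outputEnergy A C T x := by
          rw [ENNReal.ofReal_mul hpos.le, ENNReal.ofReal_toReal hκ, mul_assoc]
      _ ≤ 1 * Observability.outputEnergy A C T x := by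
          refine mul_le_mul' (ENNReal.ofReal_le_one.2 ?_) le_rfl
          rw [inv_mul_le_iff₀ (by positivity)]
          linarith
      _ = Observability.outputEnergy A C T x := one_mul _
  refine ⟨⟨√(κ.toReal + 1)⁻¹, Real.sqrt_pos.2 hpos, fun x hx _ => ?_⟩, fun _ => ?_⟩
  · rw [Real.sq_sqrt hpos.le]
    exact key x hx
  · refine lt_of_lt_of_le (ENNReal.ofReal_pos.2 hpos)
      (le_iInf fun x => le_iInf fun hx => le_iInf fun hx1 => ?_)
    simpa [hx1] using key x hx
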